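/- Let $I=[a,b]$ with $a<b$, and let $X,Y,\epsilon$ be random elements of $L^2(I)$ on a probability space with $E\|X\|^2<\infty$, $E X=0$, $X$ independent of $\epsilon$, and $$Y(t)=\int_I X(s)\beta(s,t)\,ds+\epsilon(t).$$ Let $\sigma$ be a univariate scale functional (location invariant, scale equivariant, strictly positive on laws having a density). For a law $P$ on $L^2(I)$, a system of robust (projection-pursuit) functional principal components (FPCs) of $P$ is an orthonormal family $\tilde\phi_1,\dots,\tilde\phi_n$ such that $\tilde\phi_j$ maximises $\sigma$ of the law of $\langle g,\cdot\rangle$ under $P$ over all unit vectors $g$ orthogonal to $\tilde\phi_1,\dots,\tilde\phi_{j-1}$. Let $M_0,K_0\ge 1$ and let $\{\tilde\phi^X_m\}_{m\le M_0}$, $\{\tilde\phi^Y_k\}_{k\le K_0}$ be such systems for the laws $P_X,P_Y$ of $X,Y$, with scores $\tilde\xi^X_m=\langle X,\tilde\phi^X_m\rangle$ and $\tilde\xi^Y_k=\langle Y,\tilde\phi^Y_k\rangle$. Assume: (C1), (C2) the covariance operators of $X$ and $Y$ have no nonzero eigenvalue after the $M_0$-th, respectively the $K_0$-th; (C3) $\epsilon=\sum_{k\le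 K_0}\tilde q_k\tilde\phi^Y_k$ almost surely, where $\tilde q$ is a Gaussian vector with mean $0$ and covariance matrix $\Sigma$; (C4) $\beta(s,t)=\sum_{m,k}B_{mk}\tilde\phi^X_m(s)\tilde\phi^Y_k(t)$ for some matrix $B\in\mathbb R^{M_0\times K_0}$; (C5), (C6) $(\tilde\xi^X_1,\dots,\tilde\xi^X_{M_0})$ and $(\tilde\xi^Y_1,\dots,\tilde\xi^Y_{K_0})$ have joint densities $h_1(\|x\|)$ and $h_2(\|y\|)$, with $\|\cdot\|$ the Euclidean norm and $h_1,h_2:\mathbb R\to[0,\infty)$ measurable. Let $\alpha\in(0,1]$. For a law $J$ of $(z,w)\in\mathbb R^{M_0}\times\mathbb R^{K_0}$ (row vectors), a value of the multivariate least trimmed squares (MLTS) functional is a matrix $\hat B$ that is the least squares fit of $w$ on $z$ over a measurable set $A$ with $J(A)=\alpha$ and with finite second moments on $A$, such that the trimmed sum of squares $\int_A\|w-z\hat B\|^2\,dJ$ is smallest among all such pairs $(A,\hat B)$. The robust functional linear regression functional has the values $$\tilde\beta(s,t)=\sum_{m\le M_0}\sum_{k\le K_0}\hat B_{mk}\,\tilde\phi^X_m(s)\,\tilde\phi^Y_k(t),$$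 for all robust FPC systems $\tilde\phi^X,\tilde\phi^Y$ of $P_X,P_Y$ and all MLTS values $\hat B$ at the joint law of the corresponding scores of $X$ and $Y$. Then every robust FPC system of $P_X$ (with $M_0$ elements) and of $P_Y$ (with $K_0$ elements) is a system of leading FPCs, that is, of orthonormal leading eigenfunctions of the covariance operator; and $\tilde\beta$ is Fisher-consistent: it has at least one value, and each of its values equals $\beta(s,t)$ for almost every $(s,t)\in I\times I$. If $\Sigma$ is positive definite, the same holds for $\tilde\beta$ when MLTS minimises instead the determinant of the residual scatter matrix $\alpha^{-1}\int_A (w-z\hat B)^T(w-z\hat B)\,dJ$. -/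

import Mathlib

open MeasureTheory ProbabilityTheory Set
open scoped RealInnerProductSpace NNReal ENNReal

/-- The Hilbert space `L²(I)` of square integrable functions on the interval `I = [a, b]`. -/
abbrev L2I (a b : ℝ) : Type := Lp ℝ 2 (volume.restrict (Icc a b))

/-- `L²(I)` carries its Borel σ-algebra. -/
noncomputable instance instMeasurableSpaceL2I (a b : ℝ) : MeasurableSpace (L2I a b) := borel _

instance instBorelSpaceL2I (a b : ℝ) : BorelSpace (L2I a b) := ⟨rfl⟩

section PrincipalComponents

variable {H : Type*} [NormedAddCommGroup H] [InnerProductSpace ℝ H]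

/-- The score vector `(⟪φ₁, f⟫, …, ⟪φₙ, f⟫)` of `f` with respect to `φ₁, …, φₙ`. -/
noncomputable def scores {n : ℕ} (φ : Fin n → H) (f : H) : EuclideanSpace ℝ (Fin n) :=
  WithLp.toLp 2 fun j => ⟪φ j, f⟫

variable [MeasurableSpace H]

/-- `φ₁, …, φₙ` are the first `n` functional principal components of the law `P`, with eigenvalues
`ev₁ ≥ … ≥ evₙ`: they are orthonormal eigenfunctions of the covariance operator of `P` (written in
weak form), and no direction orthogonal to all of them has variance larger than any `evⱼ`. -/
structure IsFPC (P : Measure H) {n : ℕ} (φ : Fin n → H) (ev : Fin n → ℝ) : Prop where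
  orthonormal : Orthonormal ℝ φ
  eigen : ∀ (j : Fin n) (g : H), cov[fun f => ⟪φ j, f⟫, fun f => ⟪g, f⟫; P] = ev j * ⟪φ j, g⟫
  antitone : Antitone ev
  leading : ∀ (j : Fin n) (g : H), ‖g‖ = 1 → (∀ i, ⟪φ i, g⟫ = 0) →
    Var[fun f => ⟪g, f⟫; P] ≤ ev j

/-- The law `P` has a Karhunen–Loève decomposition with at most `n` terms: all eigenvalues of its
covariance operator after the `n`-th one are zero. -/
def HasFiniteKL (P : Measure H) (n : ℕ) : Prop :=
  ∃ (φ : Fin n → H) (ev : Fin n → ℝ), IsFPC P φ ev ∧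
    ∀ g : H, (∀ i, ⟪φ i, g⟫ = 0) → Var[fun f => ⟪g, f⟫; P] = 0

/-- A univariate scale functional: defined on (at least) the probability laws on `ℝ` with finite
second moment, location invariant, scale equivariant, and nonzero on laws having a density. -/
structure IsScaleFunctional (sc : Measure ℝ → ℝ) : Prop where
  nonneg : ∀ ν : Measure ℝ, IsProbabilityMeasure ν → MemLp (fun x : ℝ => x) 2 ν → 0 ≤ sc ν
  map_affine : ∀ ν : Measure ℝ, IsProbabilityMeasure ν → MemLp (fun x : ℝ => x) 2 ν →
    ∀ c d : ℝ, sc (ν.map fun x => c * x + d) = |c| * sc ν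
  pos : ∀ ν : Measure ℝ, IsProbabilityMeasure ν → MemLp (fun x : ℝ => x) 2 ν →
    ν ≪ volume → 0 < sc ν

/-- `φ₁, …, φₙ` are projection-pursuit functional principal components of the law `P` for the scale
functional `sc`: `φⱼ` maximises the scale of the projection `⟪g, ·⟫` over all unit vectors `g`
orthogonal to `φ₁, …, φⱼ₋₁`. -/
structure IsRobustFPC (sc : Measure ℝ → ℝ) (P : Measure H) {n : ℕ} (φ : Fin n → H) : Prop where
  orthonormal : Orthonormal ℝ φ
  maximal : ∀ (j : Fin n) (g : H), ‖g‖ = 1 → (∀ i < j, ⟪φ i, g⟫ = 0) →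
    sc (P.map fun f => ⟪g, f⟫) ≤ sc (P.map fun f => ⟪φ j, f⟫)

/-- The scores of `P` along `φ₁, …, φₙ` have a joint density that is a function of the Euclidean
norm only. -/
def HasSphericalScores (P : Measure H) {n : ℕ} (φ : Fin n → H) : Prop :=
  ∃ h : ℝ → ℝ≥0, Measurable h ∧
    P.map (scores φ) = volume.withDensity fun x : EuclideanSpace ℝ (Fin n) => (h ‖x‖ : ℝ≥0∞)

/-- The law `P` is that of `∑ₖ qₖ φₖ` for a centred Gaussian vector `q` with covariance `S`. -/
def IsGaussianInSpan (P : Measure H) {n : ℕ} (φ : Fin n → H) (S : Matrix (Fin n) (Fin n) ℝ) :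
    Prop :=
  (∀ᵐ f ∂P, f = ∑ k, scores φ f k • φ k) ∧ P.map (scores φ) = multivariateGaussian 0 S

end PrincipalComponents

section TrimmedRegression

variable {M K : ℕ}

/-- The residual `w - z B` of the observation `p = (z, w)` (row vectors). -/
def regResidual (B : Matrix (Fin M) (Fin K) ℝ)
    (p : EuclideanSpace ℝ (Fin M) × EuclideanSpace ℝ (Fin K)) (k : Fin K) : ℝ :=
  p.2 k - ∑ m, p.1 m * B m k

/-- A subset of the observation space that retains the proportion `α` of the law `J`. -/
structure IsTrimmingSet (α : ℝ)
    (J : Measure (EuclideanSpace ℝ (Fin M) × EuclideanSpace ℝ (Fin K)))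
    (A : Set (EuclideanSpace ℝ (Fin M) × EuclideanSpace ℝ (Fin K))) : Prop where
  measurableSet : MeasurableSet A
  mass : J A = ENNReal.ofReal α
  memLp : MemLp (fun p => p) 2 (J.restrict A)

/-- `B` is a least squares fit of `w` on `z` over the set `A` (normal equations). -/
def IsLSFit (J : Measure (EuclideanSpace ℝ (Fin M) × EuclideanSpace ℝ (Fin K)))
    (A : Set (EuclideanSpace ℝ (Fin M) × EuclideanSpace ℝ (Fin K)))
    (B : Matrix (Fin M) (Fin K) ℝ) : Prop :=
  ∀ m k, ∫ p in A, p.1 m * regResidual B p k ∂J = 0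

/-- The scatter matrix of the residuals over the set `A`, of mass `α`. -/
noncomputable def trimmedScatter (α : ℝ)
    (J : Measure (EuclideanSpace ℝ (Fin M) × EuclideanSpace ℝ (Fin K)))
    (A : Set (EuclideanSpace ℝ (Fin M) × EuclideanSpace ℝ (Fin K)))
    (B : Matrix (Fin M) (Fin K) ℝ) : Matrix (Fin K) (Fin K) ℝ :=
  Matrix.of fun k l => α⁻¹ * ∫ p in A, regResidual B p k * regResidual B p l ∂J

/-- `B` is a value at the law `J` of the multivariate least trimmed squares functional: the least
squares fit over a set of mass `α` whose residual scatter is smallest, as measured by `crit`.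
With `crit = Matrix.trace` this minimises the trimmed sum of squares `∫_A ‖w - z B‖²`;
with `crit = Matrix.det` it is the determinant form of the estimator. -/
def IsMLTS (crit : Matrix (Fin K) (Fin K) ℝ → ℝ) (α : ℝ)
    (J : Measure (EuclideanSpace ℝ (Fin M) × EuclideanSpace ℝ (Fin K)))
    (B : Matrix (Fin M) (Fin K) ℝ) : Prop :=
  ∃ A, IsTrimmingSet α J A ∧ IsLSFit J A B ∧
    ∀ A' B', IsTrimmingSet α J A' → IsLSFit J A' B' →
      crit (trimmedScatter α J A B) ≤ crit (trimmedScatter α J A' B')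

end TrimmedRegression

section FunctionalRegression

variable {a b : ℝ}

/-- The surface `∑ₘ ∑ₖ Bₘₖ φₘ(s) ψₖ(t)`. -/
noncomputable def surface {M K : ℕ} (φ : Fin M → L2I a b) (ψ : Fin K → L2I a b)
    (B : Matrix (Fin M) (Fin K) ℝ) (s t : ℝ) : ℝ :=
  ∑ m, ∑ k, B m k * φ m s * ψ k t

/-- Equality of functions of `(s, t) ∈ I × I` up to a Lebesgue null set. -/
def EqOnSquare (a b : ℝ) (β γ : ℝ → ℝ → ℝ) : Prop :=
  ∀ᵐ p ∂((volume.restrict (Icc a b)).prod (volume.restrict (Icc a b))), β p.1 p.2 = γ p.1 p.2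

/-- The values of the robust functional linear regression functional at the joint law `J` of
predictor and response. Principal components and trimmed fits need not be unique (signs and
rotations), so the functional is set valued: every admissible choice is included. -/
def robustFLR (sc : Measure ℝ → ℝ) (α : ℝ) (M K : ℕ) (crit : Matrix (Fin K) (Fin K) ℝ → ℝ)
    (J : Measure (L2I a b × L2I a b)) : Set (ℝ → ℝ → ℝ) :=
  {γ | ∃ (φ : Fin M → L2I a b) (ψ : Fin K → L2I a b) (B : Matrix (Fin M) (Fin K) ℝ),
    IsRobustFPC sc J.fst φ ∧ IsRobustFPC sc J.snd ψ ∧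
    IsMLTS crit α (J.map fun p => (scores φ p.1, scores ψ p.2)) B ∧ γ = surface φ ψ B}

/-- A set-valued functional with value `T` is Fisher-consistent for `β`: it is defined, and all its
values are `β`. -/
def FisherConsistent (a b : ℝ) (T : Set (ℝ → ℝ → ℝ)) (β : ℝ → ℝ → ℝ) : Prop :=
  T.Nonempty ∧ ∀ γ ∈ T, EqOnSquare a b γ β

end FunctionalRegression

/-! Principal components. Sphericity of the scores makes every projection onto a direction in the
span of the given components a rescaled copy of one law, so a scale functional is a positive
constant `σ` times the norm there (`scale_lincomb`). The predictor lives on this span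
(`IsRobustFPC.ae_eq_lincomb`): a unit direction outside it that still correlated with the span could
be tilted into one of scale larger than `σ`, against the maximality of the first component. The
response lies in the span of its components because the model, the form of `β` and the form of the
error put it there. Any other robust system must then be an orthonormal basis of the same span
(`IsRobustFPC.eq_lincomb`), on which the covariance operator is a multiple of the identity; this
gives eigenfunctions.

Regression. Changing the bases of the two spans rotates the scores and transforms the coefficient
matrix, but leaves the surface unchanged. So it suffices to show that MLTS has exactly one value,
the true matrix `B`, in the model `w = zB + q`, with `z` symmetric and having a density, and `q` an
independent centred Gaussian. If `B'` replaces `B`, the residual is `q` shifted by `z(B - B')`,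
which is nonzero for almost every `z`. Trimming is handled by the bathtub principle: `∫_A R ≥ r P(A)
- ∫ (r - R)⁺`, with equality when `A` is a sublevel set at level `r`. Hence it is enough to compare
`E (r - R)⁺` conditionally on `z`, together with `E R` for the untrimmed case.

For the trace criterion, `R = ‖q + c‖²`, and the comparison is an Anderson inequality for balls,
valid also for singular covariance (`integral_max_sub_sq_lt_multivariateGaussian`). For the
determinant, errors are first standardised. A matrix of determinant one that makes the residual
moment matrix scalar turns its determinant into a power of its trace, and the comparison becomes one
between a standard Gaussian vector and its image under a volume preserving affine map
(`integral_max_sub_sq_lt_stdGaussian`). The optimum is attained on a set depending on `z` only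
through `‖z‖`, where the normal equations hold by symmetry (`exists_isTrimmingSet`). -/

/-! ### Standard Gaussian vectors under volume preserving affine maps. -/

section GaussianComparison

variable {E : Type*} [NormedAddCommGroup E] [InnerProductSpace ℝ E] [FiniteDimensional ℝ E]
  [MeasurableSpace E] [BorelSpace E]

lemma integrable_exp_neg_half_sq_norm :
    Integrable (fun x : E => Real.exp (-‖x‖ ^ 2 / 2)) := by
  have h := (GaussianFourier.integrable_cexp_neg_mul_sq_norm_add (V := E)
    (b := 1 / 2) (by norm_num) 0 0).norm
  refine h.congr (Filter.Eventually.of_forall fun x => ?_)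
  simp only [Complex.norm_exp]
  congr 1
  simp only [zero_mul, add_zero]
  rw [← Complex.ofReal_pow]
  have : (-(1 / 2 : ℂ) * ((‖x‖ ^ 2 : ℝ) : ℂ)) = ((-‖x‖ ^ 2 / 2 : ℝ) : ℂ) := by push_cast; ring
  rw [this, Complex.ofReal_re]

variable (E) in
-- Both sides have the same characteristic function. The normalising constant need not be evaluated:
-- it is the Fourier integral at frequency `0`.
lemma exists_stdGaussian_eq_withDensity :
    ∃ C : ℝ, 0 < C ∧ stdGaussian E =
      (volume : Measure E).withDensity fun x => ENNReal.ofReal (C * Real.exp (-‖x‖ ^ 2 / 2)) := by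
  set p : ℂ := (Real.pi / (1 / 2 : ℂ)) ^ (Module.finrank ℝ E / 2 : ℂ)
  set Z : ℝ := ∫ x : E, Real.exp (-‖x‖ ^ 2 / 2)
  have hZ : 0 < Z := integral_exp_pos integrable_exp_neg_half_sq_norm
  have hc : ∀ w : E, ∫ v : E, Complex.exp (-(1 / 2) * ‖v‖ ^ 2 + Complex.I * ⟪w, v⟫)
      = p * Complex.exp (-‖w‖ ^ 2 / 2) := by
    intro w
    rw [GaussianFourier.integral_cexp_neg_mul_sq_norm_add (by norm_num)]
    congr 2
    rw [Complex.I_sq]; ring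
  have hp : p = Z := by
    have h0 := hc 0
    simp only [inner_zero_left, Complex.ofReal_zero, mul_zero, add_zero, norm_zero] at h0
    norm_num at h0
    rw [← h0, ← integral_complex_ofReal]
    congr 1
    ext x
    push_cast
    congr 1
    ring
  refine ⟨Z⁻¹, by positivity, ?_⟩
  have hint : Integrable (fun x : E => Z⁻¹ * Real.exp (-‖x‖ ^ 2 / 2)) :=
    integrable_exp_neg_half_sq_norm.const_mul _
  have : IsFiniteMeasure ((volume : Measure E).withDensity
      fun x => ENNReal.ofReal (Z⁻¹ * Real.exp (-‖x‖ ^ 2 / 2))) :=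
    isFiniteMeasure_withDensity_ofReal hint.2
  refine Measure.ext_of_charFun (E := E) ?_
  ext t
  rw [charFun_stdGaussian, charFun_apply, integral_withDensity_eq_integral_toReal_smul
    (by fun_prop) (Filter.Eventually.of_forall fun _ => ENNReal.ofReal_lt_top)]
  have : ∀ x : E, (ENNReal.ofReal (Z⁻¹ * Real.exp (-‖x‖ ^ 2 / 2))).toReal •
      Complex.exp (⟪x, t⟫ * Complex.I)
      = (Z⁻¹ : ℂ) * Complex.exp (-(1 / 2) * ‖x‖ ^ 2 + Complex.I * ⟪t, x⟫) := by
    intro x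
    rw [ENNReal.toReal_ofReal (by positivity), Complex.real_smul, real_inner_comm]
    push_cast
    rw [mul_assoc, ← Complex.exp_add]
    congr 2
    ring
  simp_rw [this]
  rw [integral_const_mul, hc, hp, ← mul_assoc, inv_mul_cancel₀ (by exact_mod_cast hZ.ne'), one_mul]

variable (E) in
lemma exists_integral_stdGaussian_eq :
    ∃ C : ℝ, 0 < C ∧ (∀ f : E → ℝ, ∫ x, f x ∂stdGaussian E =
      C * ∫ x, Real.exp (-‖x‖ ^ 2 / 2) * f x) ∧
      (∀ f : E → ℝ, Integrable f (stdGaussian E) →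
        Integrable fun x => Real.exp (-‖x‖ ^ 2 / 2) * f x) := by
  obtain ⟨C, hC, h⟩ := exists_stdGaussian_eq_withDensity E
  refine ⟨C, hC, fun f => ?_, fun f hf => ?_⟩
  · rw [h, integral_withDensity_eq_integral_toReal_smul (by fun_prop)
      (Filter.Eventually.of_forall fun _ => ENNReal.ofReal_lt_top), ← integral_const_mul]
    congr 1
    ext x
    rw [ENNReal.toReal_ofReal (by positivity), smul_eq_mul, mul_assoc]
  · rw [h, integrable_withDensity_iff_integrable_smul' (by fun_prop)
      (Filter.Eventually.of_forall fun _ => ENNReal.ofReal_lt_top)] at hf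
    refine (hf.const_mul C⁻¹).congr (Filter.Eventually.of_forall fun x => ?_)
    simp only [ENNReal.toReal_ofReal (show 0 ≤ C * Real.exp (-‖x‖ ^ 2 / 2) by positivity),
      smul_eq_mul]
    field_simp

lemma stdGaussian_absolutelyContinuous : stdGaussian E ≪ volume := by
  obtain ⟨C, -, h⟩ := exists_stdGaussian_eq_withDensity E
  rw [h]
  exact withDensity_absolutelyContinuous _ _

/-- A pointwise inequality of continuous integrable functions, strict somewhere, gives a strict
inequality of integrals. -/
lemma integral_lt_of_continuous {F G : E → ℝ} (hF : Continuous F) (hG : Continuous G)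
    (hFi : Integrable F) (hGi : Integrable G) (hle : ∀ x, F x ≤ G x) {x₀ : E}
    (hlt : F x₀ < G x₀) : ∫ x, F x < ∫ x, G x := by
  rw [← sub_pos, ← integral_sub hGi hFi,
    integral_pos_iff_support_of_nonneg (fun x => sub_nonneg.2 (hle x)) (hGi.sub hFi)]
  exact ((hG.sub hF).isOpen_support).measure_pos _ ⟨x₀, (sub_pos.2 hlt).ne'⟩

omit [MeasurableSpace E] [BorelSpace E] in
lemma linear_apply_ne_zero {W : E →ₗ[ℝ] E} (hW : |LinearMap.det W| = 1) {c : E} (hc : c ≠ 0) :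
    W c ≠ 0 := by
  have hd : LinearMap.det W ≠ 0 := fun h => by simp [h] at hW
  exact fun h0 => hc ((LinearMap.equivOfDetNeZero W hd).map_eq_zero_iff.1 h0)

lemma measurePreserving_linear_add {W : E →ₗ[ℝ] E} (hW : |LinearMap.det W| = 1) (c : E) :
    MeasurePreserving (fun x => W (x + c)) := by
  have h0 : LinearMap.det W ≠ 0 := fun h => by simp [h] at hW
  have h1 : MeasurePreserving (⇑W) (volume : Measure E) volume :=
    ⟨W.continuous_of_finiteDimensional.measurable, by
      rw [Measure.map_linearMap_addHaar_eq_smul_addHaar _ h0, abs_inv, hW]; simp⟩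
  exact h1.comp (measurePreserving_add_right volume c)

/-- Convexity: the tangent of `x ↦ exp (-x / 2)` at `t` lies below the graph at `s`. -/
lemma exp_neg_half_mul_le {s t : ℝ} :
    Real.exp (-t / 2) * (t - s) ≤ 2 * (Real.exp (-s / 2) - Real.exp (-t / 2)) := by
  have h := Real.add_one_le_exp ((t - s) / 2)
  have h2 : Real.exp (-s / 2) = Real.exp (-t / 2) * Real.exp ((t - s) / 2) := by
    rw [← Real.exp_add]; congr 1; ring
  rw [h2]
  nlinarith [Real.exp_pos (-t / 2)]

lemma exp_neg_half_mul_lt {s t : ℝ} (hst : s ≠ t) :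
    Real.exp (-t / 2) * (t - s) < 2 * (Real.exp (-s / 2) - Real.exp (-t / 2)) := by
  have h := Real.add_one_lt_exp (x := (t - s) / 2)
    (by intro h; apply hst; linarith)
  have h2 : Real.exp (-s / 2) = Real.exp (-t / 2) * Real.exp ((t - s) / 2) := by
    rw [← Real.exp_add]; congr 1; ring
  rw [h2]
  nlinarith [Real.exp_pos (-t / 2)]

/-- This is the tangent inequality for `min s r` and `min t r`, because `(r - s)⁺ - (r - t)⁺ = min t
r - min s r`. When `t > r` that difference is nonnegative, so the factor `exp (-r / 2)` may be
lowered to `exp (-t / 2)`. -/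
lemma exp_neg_half_mul_max_le (r s t : ℝ) :
    Real.exp (-t / 2) * max (r - s) 0 + 2 * max (Real.exp (-t / 2) - Real.exp (-r / 2)) 0 ≤
      2 * max (Real.exp (-s / 2) - Real.exp (-r / 2)) 0 + Real.exp (-t / 2) * max (r - t) 0 := by
  have hmono : ∀ {x y : ℝ}, x ≤ y → Real.exp (-y / 2) ≤ Real.exp (-x / 2) := fun h =>
    Real.exp_le_exp.2 (by linarith)
  have het := Real.exp_pos (-t / 2)
  rcases le_total s r with hs | hs <;> rcases le_total t r with ht | ht
  · rw [max_eq_left (by linarith), max_eq_left (sub_nonneg.2 (hmono ht)),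
      max_eq_left (sub_nonneg.2 (hmono hs)), max_eq_left (by linarith)]
    linarith [exp_neg_half_mul_le (s := s) (t := t)]
  · rw [max_eq_left (by linarith), max_eq_right (sub_nonpos.2 (hmono ht)),
      max_eq_left (sub_nonneg.2 (hmono hs)), max_eq_right (by linarith)]
    have := exp_neg_half_mul_le (s := s) (t := r)
    nlinarith [hmono ht]
  · rw [max_eq_right (by linarith), max_eq_left (sub_nonneg.2 (hmono ht)),
      max_eq_right (sub_nonpos.2 (hmono hs)), max_eq_left (by linarith)]
    have := exp_neg_half_mul_le (s := r) (t := t)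
    linarith
  · rw [max_eq_right (by linarith), max_eq_right (sub_nonpos.2 (hmono ht)),
      max_eq_right (sub_nonpos.2 (hmono hs)), max_eq_right (by linarith)]
    linarith

lemma exp_neg_half_mul_max_lt {r s t : ℝ} (ht : t < r) (hst : s ≠ t) :
    Real.exp (-t / 2) * max (r - s) 0 + 2 * max (Real.exp (-t / 2) - Real.exp (-r / 2)) 0 <
      2 * max (Real.exp (-s / 2) - Real.exp (-r / 2)) 0 + Real.exp (-t / 2) * max (r - t) 0 := by
  have hmono : ∀ {x y : ℝ}, x ≤ y → Real.exp (-y / 2) ≤ Real.exp (-x / 2) := fun h =>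
    Real.exp_le_exp.2 (by linarith)
  rcases le_total s r with hs | hs
  · rw [max_eq_left (by linarith), max_eq_left (sub_nonneg.2 (hmono ht.le)),
      max_eq_left (sub_nonneg.2 (hmono hs)), max_eq_left (by linarith)]
    linarith [exp_neg_half_mul_lt hst]
  · rw [max_eq_right (by linarith), max_eq_left (sub_nonneg.2 (hmono ht.le)),
      max_eq_right (sub_nonpos.2 (hmono hs)), max_eq_left (by linarith)]
    have := exp_neg_half_mul_lt (s := r) (t := t) ht.ne'
    linarith

lemma integrable_exp_mul_of_bounded {f : E → ℝ} (hf : Continuous f) {M : ℝ}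
    (hM : ∀ x, |f x| ≤ M) : Integrable fun x : E => Real.exp (-‖x‖ ^ 2 / 2) * f x :=
  integrable_exp_neg_half_sq_norm.mul_bdd (c := M) hf.aestronglyMeasurable
    (Filter.Eventually.of_forall hM)

lemma abs_max_sub_sq_le (r s : ℝ) (hs : 0 ≤ s) : |max (r - s) 0| ≤ |r| := by
  rw [abs_of_nonneg (le_max_right _ _)]
  exact max_le (by linarith [le_abs_self r]) (abs_nonneg r)

lemma integrable_max_exp_sub (r : ℝ) :
    Integrable fun x : E => max (Real.exp (-‖x‖ ^ 2 / 2) - Real.exp (-r / 2)) 0 := by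
  refine integrable_exp_neg_half_sq_norm.mono' (by fun_prop)
    (Filter.Eventually.of_forall fun x => ?_)
  rw [Real.norm_of_nonneg (le_max_right _ _)]
  exact max_le (by linarith [Real.exp_pos (-r / 2)]) (Real.exp_pos _).le

lemma memLp_two_linear_add_stdGaussian (W : E →ₗ[ℝ] E) (c : E) :
    MemLp (fun x => W (x + c)) 2 (stdGaussian E) := by
  have h1 : MemLp (fun x : E => x + c) 2 (stdGaussian E) :=
    (IsGaussian.memLp_two_id (μ := stdGaussian E)).add (memLp_const c)
  have h2 := (LinearMap.toContinuousLinearMap W).comp_memLp' h1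
  exact h2

/-- Integrate `exp_neg_half_mul_max_le` with `s = ‖W (x + c)‖ ^ 2` and `t = ‖x‖ ^ 2` over Lebesgue
measure. The two purely exponential terms have equal integrals, since `x ↦ W (x + c)` preserves
volume, and cancel. -/
lemma integral_max_sub_sq_le_stdGaussian {W : E →ₗ[ℝ] E} (hW : |LinearMap.det W| = 1) (c : E)
    (r : ℝ) :
    ∫ x, max (r - ‖W (x + c)‖ ^ 2) 0 ∂stdGaussian E ≤
      ∫ x, max (r - ‖x‖ ^ 2) 0 ∂stdGaussian E := by
  obtain ⟨C, hC, h, -⟩ := exists_integral_stdGaussian_eq E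
  have hWc : Continuous W := W.continuous_of_finiteDimensional
  rw [h, h]
  refine mul_le_mul_of_nonneg_left ?_ hC.le
  have hmp := measurePreserving_linear_add hW c
  have hi1 := integrable_exp_mul_of_bounded (E := E) (f := fun x => max (r - ‖W (x + c)‖ ^ 2) 0)
    (by fun_prop) fun x => abs_max_sub_sq_le r _ (by positivity)
  have hi2 := integrable_exp_mul_of_bounded (E := E) (f := fun x => max (r - ‖x‖ ^ 2) 0)
    (by fun_prop) fun x => abs_max_sub_sq_le r _ (by positivity)
  have hi3 := (integrable_max_exp_sub (E := E) r).const_mul 2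
  have hi4 := hmp.integrable_comp_of_integrable hi3
  have key := integral_mono (hi1.add hi3) (hi4.add hi2) fun x =>
    exp_neg_half_mul_max_le r (‖W (x + c)‖ ^ 2) (‖x‖ ^ 2)
  rw [integral_add' hi1 hi3, integral_add' hi4 hi2] at key
  have heq := integral_map (μ := (volume : Measure E)) hmp.measurable.aemeasurable
    (f := fun x : E => 2 * max (Real.exp (-‖x‖ ^ 2 / 2) - Real.exp (-r / 2)) 0) (by fun_prop)
  rw [hmp.map_eq] at heq
  simp only [Function.comp_def] at key
  linarith

lemma integral_max_sub_sq_lt_stdGaussian {W : E →ₗ[ℝ] E} (hW : |LinearMap.det W| = 1) {c : E}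
    (hc : c ≠ 0) {r : ℝ} (hr : 0 < r) :
    ∫ x, max (r - ‖W (x + c)‖ ^ 2) 0 ∂stdGaussian E <
      ∫ x, max (r - ‖x‖ ^ 2) 0 ∂stdGaussian E := by
  obtain ⟨C, hC, h, -⟩ := exists_integral_stdGaussian_eq E
  have hWc : Continuous W := W.continuous_of_finiteDimensional
  have hWi : W c ≠ 0 := linear_apply_ne_zero hW hc
  rw [h, h]
  refine mul_lt_mul_of_pos_left ?_ hC
  have hmp := measurePreserving_linear_add hW c
  have hi1 := integrable_exp_mul_of_bounded (E := E) (f := fun x => max (r - ‖W (x + c)‖ ^ 2) 0)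
    (by fun_prop) fun x => abs_max_sub_sq_le r _ (by positivity)
  have hi2 := integrable_exp_mul_of_bounded (E := E) (f := fun x => max (r - ‖x‖ ^ 2) 0)
    (by fun_prop) fun x => abs_max_sub_sq_le r _ (by positivity)
  have hi3 := (integrable_max_exp_sub (E := E) r).const_mul 2
  have hi4 := hmp.integrable_comp_of_integrable hi3
  -- At the origin `t = 0 < r` and `s = ‖W c‖ ^ 2 ≠ 0`, so the pointwise inequality is strict there,
  -- and by continuity nearby.
  have key := integral_lt_of_continuous (by fun_prop) (by fun_prop) (hi1.add hi3) (hi4.add hi2)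
    (fun x => exp_neg_half_mul_max_le r (‖W (x + c)‖ ^ 2) (‖x‖ ^ 2)) (x₀ := 0)
    (exp_neg_half_mul_max_lt (by simpa using hr) (by simpa using hWi))
  rw [integral_add' hi1 hi3, integral_add' hi4 hi2] at key
  have heq := integral_map (μ := (volume : Measure E)) hmp.measurable.aemeasurable
    (f := fun x : E => 2 * max (Real.exp (-‖x‖ ^ 2 / 2) - Real.exp (-r / 2)) 0) (by fun_prop)
  rw [hmp.map_eq] at heq
  simp only [Function.comp_def] at key
  linarith

lemma integrable_sq_norm_linear_add_stdGaussian (W : E →ₗ[ℝ] E) (c : E) :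
    Integrable (fun x => ‖W (x + c)‖ ^ 2) (stdGaussian E) :=
  (memLp_two_linear_add_stdGaussian W c).integrable_norm_pow (by norm_num)

lemma integrable_sq_norm_stdGaussian : Integrable (fun x => ‖x‖ ^ 2) (stdGaussian E) := by
  simpa using integrable_sq_norm_linear_add_stdGaussian (E := E) LinearMap.id 0

/-- The untrimmed counterpart, needed when the retained set has full mass; the plain tangent
inequality replaces the truncated one. -/
lemma integral_sq_norm_le_stdGaussian {W : E →ₗ[ℝ] E} (hW : |LinearMap.det W| = 1) (c : E) :
    ∫ x, ‖x‖ ^ 2 ∂stdGaussian E ≤ ∫ x, ‖W (x + c)‖ ^ 2 ∂stdGaussian E := by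
  obtain ⟨C, hC, h, h'⟩ := exists_integral_stdGaussian_eq E
  rw [h, h]
  refine mul_le_mul_of_nonneg_left ?_ hC.le
  have hmp := measurePreserving_linear_add hW c
  have hi1 := h' _ (integrable_sq_norm_linear_add_stdGaussian W c)
  have hi2 := h' _ (integrable_sq_norm_stdGaussian (E := E))
  have hi3 := (integrable_exp_neg_half_sq_norm (E := E)).const_mul 2
  have hi4 := hmp.integrable_comp_of_integrable hi3
  have key := integral_mono (hi2.add hi3) (hi4.add hi1) fun x => by
    have := exp_neg_half_mul_le (s := ‖W (x + c)‖ ^ 2) (t := ‖x‖ ^ 2)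
    simp only [Pi.add_apply, Function.comp_apply]
    linarith
  rw [integral_add' hi2 hi3, integral_add' hi4 hi1] at key
  have heq := integral_map (μ := (volume : Measure E)) hmp.measurable.aemeasurable
    (f := fun x : E => 2 * Real.exp (-‖x‖ ^ 2 / 2)) (by fun_prop)
  rw [hmp.map_eq] at heq
  simp only [Function.comp_def] at key
  linarith

lemma integral_sq_norm_lt_stdGaussian {W : E →ₗ[ℝ] E} (hW : |LinearMap.det W| = 1) {c : E}
    (hc : c ≠ 0) :
    ∫ x, ‖x‖ ^ 2 ∂stdGaussian E < ∫ x, ‖W (x + c)‖ ^ 2 ∂stdGaussian E := by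
  obtain ⟨C, hC, h, h'⟩ := exists_integral_stdGaussian_eq E
  have hWc : Continuous W := W.continuous_of_finiteDimensional
  have hWi : W c ≠ 0 := linear_apply_ne_zero hW hc
  rw [h, h]
  refine mul_lt_mul_of_pos_left ?_ hC
  have hmp := measurePreserving_linear_add hW c
  have hi1 := h' _ (integrable_sq_norm_linear_add_stdGaussian W c)
  have hi2 := h' _ (integrable_sq_norm_stdGaussian (E := E))
  have hi3 := (integrable_exp_neg_half_sq_norm (E := E)).const_mul 2
  have hi4 := hmp.integrable_comp_of_integrable hi3
  have key := integral_lt_of_continuous (by fun_prop) (by fun_prop) (hi2.add hi3) (hi4.add hi1)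
    (fun x => by
      have := exp_neg_half_mul_le (s := ‖W (x + c)‖ ^ 2) (t := ‖x‖ ^ 2)
      simp only [Pi.add_apply, Function.comp_apply]
      linarith) (x₀ := 0) (by
      have := exp_neg_half_mul_lt (s := ‖W (0 + c)‖ ^ 2) (t := ‖(0 : E)‖ ^ 2) (by simpa using hWi)
      simp only [Pi.add_apply, Function.comp_apply]
      linarith)
  rw [integral_add' hi2 hi3, integral_add' hi4 hi1] at key
  have heq := integral_map (μ := (volume : Measure E)) hmp.measurable.aemeasurable
    (f := fun x : E => 2 * Real.exp (-‖x‖ ^ 2 / 2)) (by fun_prop)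
  rw [hmp.map_eq] at heq
  simp only [Function.comp_def] at key
  linarith

end GaussianComparison

/-! ### Anderson's inequality for balls, by reflecting one coordinate at a time. -/

section AndersonBall

variable {ι : Type*} [Fintype ι] [DecidableEq ι]

/-- The reflection `uᵢ ↦ -uᵢ - δ` of one coordinate. -/
noncomputable def coordReflection (i : ι) (δ : ℝ) (u : EuclideanSpace ℝ ι) : EuclideanSpace ℝ ι :=
  LinearIsometryEquiv.piLpCongrRight 2
    (fun k => if k = i then LinearIsometryEquiv.neg ℝ else LinearIsometryEquiv.refl ℝ ℝ)
    (u + EuclideanSpace.single i δ)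

lemma coordReflection_same (i : ι) (δ : ℝ) (u : EuclideanSpace ℝ ι) :
    coordReflection i δ u i = -u i - δ := by
  simp [coordReflection]; ring

lemma coordReflection_of_ne {i k : ι} (h : k ≠ i) (δ : ℝ) (u : EuclideanSpace ℝ ι) :
    coordReflection i δ u k = u k := by
  simp [coordReflection, h]

lemma coordReflection_involutive (i : ι) (δ : ℝ) (u : EuclideanSpace ℝ ι) :
    coordReflection i δ (coordReflection i δ u) = u := by
  ext k
  by_cases h : k = i
  · subst h; rw [coordReflection_same, coordReflection_same]; ring
  · rw [coordReflection_of_ne h, coordReflection_of_ne h]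

lemma continuous_coordReflection (i : ι) (δ : ℝ) : Continuous (coordReflection i δ) :=
  (LinearIsometryEquiv.continuous _).comp (continuous_id.add continuous_const)

lemma measurePreserving_coordReflection (i : ι) (δ : ℝ) :
    MeasurePreserving (coordReflection i δ) :=
  (LinearIsometryEquiv.measurePreserving _).comp (measurePreserving_add_right volume _)

lemma sum_sq_coordReflection (i : ι) (δ : ℝ) (t c : ι → ℝ) (u : EuclideanSpace ℝ ι) :
    ∑ k, (t k * coordReflection i δ u k + c k) ^ 2 =
      (t i * (-u i - δ) + c i) ^ 2 + ∑ k ∈ Finset.univ.erase i, (t k * u k + c k) ^ 2 := by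
  rw [← Finset.add_sum_erase _ _ (Finset.mem_univ i), coordReflection_same]
  congr 1
  refine Finset.sum_congr rfl fun k hk => ?_
  rw [coordReflection_of_ne (Finset.ne_of_mem_erase hk)]

/-- Rearrangement: `a, b` and `A, B` are ordered alike and both functions are decreasing, so pairing
like with like gives the larger sum. -/
lemma exp_mul_max_rearrange {a b A B τ : ℝ} (r : ℝ) (hτ : 0 ≤ τ) (h : B - A = τ * (b - a)) :
    Real.exp (-a / 2) * max (r - B) 0 + Real.exp (-b / 2) * max (r - A) 0 ≤
      Real.exp (-a / 2) * max (r - A) 0 + Real.exp (-b / 2) * max (r - B) 0 := by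
  rcases le_total a b with hab | hab
  · have h1 : Real.exp (-b / 2) ≤ Real.exp (-a / 2) := Real.exp_le_exp.2 (by linarith)
    have h2 : max (r - B) 0 ≤ max (r - A) 0 := max_le_max (by nlinarith) le_rfl
    nlinarith
  · have h1 : Real.exp (-a / 2) ≤ Real.exp (-b / 2) := Real.exp_le_exp.2 (by linarith)
    have h2 : max (r - A) 0 ≤ max (r - B) 0 := max_le_max (by nlinarith) le_rfl
    nlinarith

/-- The expected truncated distance `E (r - ∑ₖ (tₖ uₖ + cₖ)²)⁺` for a standard Gaussian `u`. -/
noncomputable def truncatedShift (t : ι → ℝ) (r : ℝ) (c : ι → ℝ) : ℝ :=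
  ∫ u : EuclideanSpace ℝ ι, max (r - ∑ k, (t k * u k + c k) ^ 2) 0 ∂stdGaussian _

omit [DecidableEq ι] in
lemma integrable_exp_mul_truncatedShift (t : ι → ℝ) (r : ℝ) (c : ι → ℝ) :
    Integrable fun u : EuclideanSpace ℝ ι =>
      Real.exp (-‖u‖ ^ 2 / 2) * max (r - ∑ k, (t k * u k + c k) ^ 2) 0 :=
  integrable_exp_mul_of_bounded (by fun_prop) fun x =>
    abs_max_sub_sq_le r _ (Finset.sum_nonneg fun _ _ => sq_nonneg _)

/-- A reflection of coordinate `i` exchanges the squared distances with and without the shift `c i`,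
so symmetrising over it reduces the claim to `exp_mul_max_rearrange`. Strictness is claimed only
when `c i` is the last nonzero shift, where it can be read off at the origin. -/
lemma truncatedShift_le_update (t : ι → ℝ) (r : ℝ) (c : ι → ℝ) (i : ι) :
    truncatedShift t r c ≤ truncatedShift t r (Function.update c i 0) ∧
      (c i ≠ 0 → 0 < r → Function.update c i 0 = 0 →
        truncatedShift t r c < truncatedShift t r (Function.update c i 0)) := by
  obtain ⟨C, hC, h, -⟩ := exists_integral_stdGaussian_eq (EuclideanSpace ℝ ι)
  unfold truncatedShift
  rw [h, h]
  set c' := Function.update c i 0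
  have hc'i : c' i = 0 := by simp [c']
  have hc' : ∀ k ∈ Finset.univ.erase i, c' k = c k := fun k hk => by
    simp [c', Finset.ne_of_mem_erase hk]
  have hi1 := integrable_exp_mul_truncatedShift t r c
  have hi2 := integrable_exp_mul_truncatedShift t r c'
  have hsum : ∀ u : EuclideanSpace ℝ ι, ∑ k, (t k * u k + c k) ^ 2 =
      (t i * u i + c i) ^ 2 + ∑ k ∈ Finset.univ.erase i, (t k * u k + c k) ^ 2 := fun u =>
    (Finset.add_sum_erase _ _ (Finset.mem_univ i)).symm
  have hsum' : ∀ u : EuclideanSpace ℝ ι, ∑ k, (t k * u k + c' k) ^ 2 =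
      (t i * u i) ^ 2 + ∑ k ∈ Finset.univ.erase i, (t k * u k + c k) ^ 2 := fun u => by
    rw [← Finset.add_sum_erase _ _ (Finset.mem_univ i), hc'i, add_zero]
    congr 1
    exact Finset.sum_congr rfl fun k hk => by rw [hc' k hk]
  -- In a degenerate direction there is nothing to reflect, but there the shift simply adds `c i ^
  -- 2` to the squared distance.
  by_cases hti : t i = 0
  · have hle : ∀ u : EuclideanSpace ℝ ι,
        Real.exp (-‖u‖ ^ 2 / 2) * max (r - ∑ k, (t k * u k + c k) ^ 2) 0 ≤
        Real.exp (-‖u‖ ^ 2 / 2) * max (r - ∑ k, (t k * u k + c' k) ^ 2) 0 := fun u => by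
      refine mul_le_mul_of_nonneg_left (max_le_max ?_ le_rfl) (Real.exp_pos _).le
      rw [hsum, hsum', hti]
      nlinarith [sq_nonneg (c i)]
    refine ⟨mul_le_mul_of_nonneg_left (integral_mono hi1 hi2 hle) hC.le, fun hci hr h0 =>
      mul_lt_mul_of_pos_left (integral_lt_of_continuous (by fun_prop) (by fun_prop)
        hi1 hi2 hle (x₀ := 0) ?_) hC⟩
    refine mul_lt_mul_of_pos_left ?_ (Real.exp_pos _)
    rw [hsum, h0]
    have h3 : 0 ≤ ∑ k ∈ Finset.univ.erase i, (t k * (0 : EuclideanSpace ℝ ι) k + c k) ^ 2 :=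
      Finset.sum_nonneg fun _ _ => sq_nonneg _
    have h4 : 0 < (t i * (0 : EuclideanSpace ℝ ι) i + c i) ^ 2 := by
      rw [hti]; simpa using sq_pos_of_ne_zero hci
    simp only [PiLp.zero_apply, mul_zero, Pi.zero_apply, add_zero, zero_pow two_ne_zero,
      Finset.sum_const_zero, sub_zero] at *
    rw [max_eq_left hr.le]
    exact max_lt (by linarith) hr
  -- With this `δ`, `t i * (-u i - δ) = -(t i * u i + c i)`, and the two squared distances differ by
  -- `t i ^ 2` times the change of `‖u‖ ^ 2` under the reflection.
  · set δ := c i / t i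
    have hδ : t i * δ = c i := by simp only [δ]; field_simp
    set L := coordReflection i δ
    have hLL : ∀ u, L (L u) = u := coordReflection_involutive i δ
    have hLc : Continuous L := continuous_coordReflection i δ
    have hmp : MeasurePreserving L := measurePreserving_coordReflection i δ
    have hL : ∀ u, ∑ k, (t k * L u k + c' k) ^ 2 = ∑ k, (t k * u k + c k) ^ 2 := fun u => by
      rw [sum_sq_coordReflection, hsum, hc'i]
      congr 1
      · rw [← hδ]; ring
      · exact Finset.sum_congr rfl fun k hk => by rw [hc' k hk]
    have hn : ∀ u, ‖L u‖ ^ 2 - ‖u‖ ^ 2 = (u i + δ) ^ 2 - (u i) ^ 2 := fun u => by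
      have h1 := sum_sq_coordReflection i δ (fun _ => 1) (fun _ => 0) u
      simp only [one_mul, add_zero] at h1
      rw [EuclideanSpace.real_norm_sq_eq, EuclideanSpace.real_norm_sq_eq, h1,
        ← Finset.add_sum_erase _ _ (Finset.mem_univ i)]
      ring
    have hle : ∀ u : EuclideanSpace ℝ ι,
        Real.exp (-‖u‖ ^ 2 / 2) * max (r - ∑ k, (t k * u k + c k) ^ 2) 0 +
          Real.exp (-‖L u‖ ^ 2 / 2) * max (r - ∑ k, (t k * u k + c' k) ^ 2) 0 ≤
        Real.exp (-‖u‖ ^ 2 / 2) * max (r - ∑ k, (t k * u k + c' k) ^ 2) 0 +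
          Real.exp (-‖L u‖ ^ 2 / 2) * max (r - ∑ k, (t k * u k + c k) ^ 2) 0 := fun u => by
      refine exp_mul_max_rearrange r (sq_nonneg (t i)) ?_
      rw [hn, hsum, hsum', ← hδ]
      ring
    have hi3 : Integrable fun u : EuclideanSpace ℝ ι =>
        Real.exp (-‖L u‖ ^ 2 / 2) * max (r - ∑ k, (t k * u k + c' k) ^ 2) 0 := by
      refine (hmp.integrable_comp_of_integrable hi1).congr (Filter.Eventually.of_forall fun u => ?_)
      simp only [Function.comp_apply]
      rw [← hL (L u), hLL]
    have hi4 : Integrable fun u : EuclideanSpace ℝ ι =>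
        Real.exp (-‖L u‖ ^ 2 / 2) * max (r - ∑ k, (t k * u k + c k) ^ 2) 0 := by
      refine (hmp.integrable_comp_of_integrable hi2).congr (Filter.Eventually.of_forall fun u => ?_)
      simp only [Function.comp_apply]
      rw [hL]
    have he3 : ∫ u : EuclideanSpace ℝ ι,
        Real.exp (-‖L u‖ ^ 2 / 2) * max (r - ∑ k, (t k * u k + c' k) ^ 2) 0 =
        ∫ u : EuclideanSpace ℝ ι,
          Real.exp (-‖u‖ ^ 2 / 2) * max (r - ∑ k, (t k * u k + c k) ^ 2) 0 := by
      have := integral_map (μ := (volume : Measure (EuclideanSpace ℝ ι)))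
        hmp.measurable.aemeasurable (f := fun u : EuclideanSpace ℝ ι =>
          Real.exp (-‖u‖ ^ 2 / 2) * max (r - ∑ k, (t k * u k + c k) ^ 2) 0) (by fun_prop)
      rw [hmp.map_eq] at this
      rw [this]
      refine integral_congr_ae (Filter.Eventually.of_forall fun u => ?_)
      simp only []
      rw [← hL (L u), hLL]
    have he4 : ∫ u : EuclideanSpace ℝ ι,
        Real.exp (-‖L u‖ ^ 2 / 2) * max (r - ∑ k, (t k * u k + c k) ^ 2) 0 =
        ∫ u : EuclideanSpace ℝ ι,
          Real.exp (-‖u‖ ^ 2 / 2) * max (r - ∑ k, (t k * u k + c' k) ^ 2) 0 := by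
      have := integral_map (μ := (volume : Measure (EuclideanSpace ℝ ι)))
        hmp.measurable.aemeasurable (f := fun u : EuclideanSpace ℝ ι =>
          Real.exp (-‖u‖ ^ 2 / 2) * max (r - ∑ k, (t k * u k + c' k) ^ 2) 0) (by fun_prop)
      rw [hmp.map_eq] at this
      rw [this]
      refine integral_congr_ae (Filter.Eventually.of_forall fun u => ?_)
      simp only []
      rw [hL]
    constructor
    · have key := integral_mono (hi1.add hi3) (hi2.add hi4) hle
      rw [integral_add' hi1 hi3, integral_add' hi2 hi4, he3, he4] at key
      exact mul_le_mul_of_nonneg_left (by linarith) hC.le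
    · intro hci hr h0
      have key := integral_lt_of_continuous (by fun_prop) (by fun_prop) (hi1.add hi3)
        (hi2.add hi4) hle (x₀ := 0) (by
          have h5 := hn 0
          simp only [PiLp.zero_apply, zero_add, zero_pow two_ne_zero, sub_zero, norm_zero] at h5
          have hδ0 : 0 < δ ^ 2 := by
            refine sq_pos_of_ne_zero fun h => hci ?_
            rw [← hδ, h, mul_zero]
          have h6 : Real.exp (-‖L 0‖ ^ 2 / 2) < Real.exp (-‖(0 : EuclideanSpace ℝ ι)‖ ^ 2 / 2) := by
            rw [norm_zero]
            exact Real.exp_lt_exp.2 (by simp; linarith)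
          have h7 : max (r - ∑ k, (t k * (0 : EuclideanSpace ℝ ι) k + c k) ^ 2) 0 <
              max (r - ∑ k, (t k * (0 : EuclideanSpace ℝ ι) k + c' k) ^ 2) 0 := by
            rw [hsum, h0]
            have h3 : 0 ≤ ∑ k ∈ Finset.univ.erase i,
              (t k * (0 : EuclideanSpace ℝ ι) k + c k) ^ 2 :=
              Finset.sum_nonneg fun _ _ => sq_nonneg _
            have h4 : 0 < (c i) ^ 2 := sq_pos_of_ne_zero hci
            simp only [PiLp.zero_apply, mul_zero, Pi.zero_apply, add_zero, zero_pow two_ne_zero,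
              Finset.sum_const_zero, sub_zero, zero_add] at *
            rw [max_eq_left hr.le]
            exact max_lt (by linarith) hr
          simp only [Pi.add_apply]
          nlinarith)
      rw [integral_add' hi1 hi3, integral_add' hi2 hi4, he3, he4] at key
      exact mul_lt_mul_of_pos_left (by linarith) hC

lemma truncatedShift_le_piecewise (t : ι → ℝ) (r : ℝ) (c : ι → ℝ) (s : Finset ι) :
    truncatedShift t r c ≤ truncatedShift t r (fun k => if k ∈ s then 0 else c k) := by
  induction s using Finset.induction_on with
  | empty => simp
  | insert a s ha ih =>
    refine (ih.trans (truncatedShift_le_update t r _ a).1).trans_eq ?_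
    congr 1
    ext k
    by_cases hk : k = a <;> simp [hk]

/-- Remove every shift except one nonzero one, without loss; removing that last one is strict. -/
lemma truncatedShift_lt_zero_shift (t : ι → ℝ) {r : ℝ} (hr : 0 < r) {c : ι → ℝ} (hc : c ≠ 0) :
    truncatedShift t r c < truncatedShift t r 0 := by
  obtain ⟨i, hi⟩ := Function.ne_iff.1 hc
  refine (truncatedShift_le_piecewise t r c (Finset.univ.erase i)).trans_lt ?_
  have hu : Function.update (fun k => if k ∈ Finset.univ.erase i then 0 else c k) i 0 = 0 := by
    ext k
    by_cases hk : k = i <;> simp [hk]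
  have := (truncatedShift_le_update t r (fun k => if k ∈ Finset.univ.erase i then 0 else c k) i).2
    (by simpa using hi) hr hu
  rwa [hu] at this

end AndersonBall

/-- In an eigenbasis of `T` the shifted vector has coordinates `t k * u k + c k`, and the standard
Gaussian is rotation invariant. Zero eigenvalues are allowed, so singular covariances are covered.
-/
lemma integral_max_sub_sq_lt_of_isSymmetric {K : ℕ}
    {T : EuclideanSpace ℝ (Fin K) →ₗ[ℝ] EuclideanSpace ℝ (Fin K)} (hT : T.IsSymmetric)
    {c : EuclideanSpace ℝ (Fin K)} (hc : c ≠ 0) {r : ℝ} (hr : 0 < r) :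
    ∫ u, max (r - ‖T u + c‖ ^ 2) 0 ∂stdGaussian (EuclideanSpace ℝ (Fin K)) <
      ∫ u, max (r - ‖T u‖ ^ 2) 0 ∂stdGaussian (EuclideanSpace ℝ (Fin K)) := by
  have hdim := finrank_euclideanSpace_fin (𝕜 := ℝ) (n := K)
  set b := hT.eigenvectorBasis hdim with hb
  set t := hT.eigenvalues hdim with ht
  have hTc : Continuous T := T.continuous_of_finiteDimensional
  have hnorm : ∀ u d : EuclideanSpace ℝ (Fin K), ‖T (b.repr.symm u) + d‖ ^ 2 =
      ∑ k, (t k * u k + b.repr d k) ^ 2 := by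
    intro u d
    rw [← b.repr.norm_map, EuclideanSpace.real_norm_sq_eq]
    refine Finset.sum_congr rfl fun k _ => ?_
    have h1 : T (b k) = t k • b k := by
      exact hT.apply_eigenvectorBasis hdim k
    have h2 : b.repr (T (b.repr.symm u)) k = t k * u k := by
      rw [b.repr_apply_apply, ← hT, h1, real_inner_smul_left, ← b.repr_apply_apply,
        LinearIsometryEquiv.apply_symm_apply]
    rw [map_add, PiLp.add_apply, h2]
  have hint : ∀ d, ∫ u, max (r - ‖T u + d‖ ^ 2) 0 ∂stdGaussian (EuclideanSpace ℝ (Fin K)) =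
      truncatedShift t r (b.repr d) := by
    intro d
    conv_lhs => rw [← stdGaussian_map (b.repr.symm)]
    rw [integral_map (by fun_prop) (by fun_prop), truncatedShift]
    simp_rw [hnorm]
  have h0 := hint 0
  simp only [add_zero, map_zero] at h0
  rw [hint, h0]
  refine truncatedShift_lt_zero_shift t hr fun h => hc ?_
  apply b.repr.injective
  rw [map_zero]
  ext k
  exact congrFun h k

open scoped MatrixOrder in
lemma isSymmetric_toEuclideanCLM_sqrt {K : ℕ} (S : Matrix (Fin K) (Fin K) ℝ) :
    (Matrix.toEuclideanCLM (𝕜 := ℝ) (CFC.sqrt S)).toLinearMap.IsSymmetric := by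
  have h1 : IsSelfAdjoint (Matrix.toEuclideanCLM (𝕜 := ℝ) (CFC.sqrt S)) :=
    (CFC.sqrt_nonneg S).isSelfAdjoint.map _
  exact ContinuousLinearMap.isSelfAdjoint_iff_isSymmetric.1 h1

lemma integral_max_sub_sq_lt_multivariateGaussian {K : ℕ} (S : Matrix (Fin K) (Fin K) ℝ)
    {c : EuclideanSpace ℝ (Fin K)} (hc : c ≠ 0) {r : ℝ} (hr : 0 < r) :
    ∫ q, max (r - ‖q + c‖ ^ 2) 0 ∂multivariateGaussian 0 S <
      ∫ q, max (r - ‖q‖ ^ 2) 0 ∂multivariateGaussian 0 S := by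
  rw [multivariateGaussian, integral_map (by fun_prop) (by fun_prop),
    integral_map (by fun_prop) (by fun_prop)]
  simp only [zero_add]
  exact integral_max_sub_sq_lt_of_isSymmetric (isSymmetric_toEuclideanCLM_sqrt S) hc hr

lemma integral_sq_norm_add_of_centred {F : Type*} [NormedAddCommGroup F] [InnerProductSpace ℝ F]
    [MeasurableSpace F] [CompleteSpace F]
    {κ : Measure F} [IsProbabilityMeasure κ] (hκ : MemLp id 2 κ) (h0 : ∫ q, q ∂κ = 0) (c : F) :
    ∫ q, ‖q + c‖ ^ 2 ∂κ = ∫ q, ‖q‖ ^ 2 ∂κ + ‖c‖ ^ 2 := by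
  have h1 : Integrable (fun q : F => q) κ := hκ.integrable (by norm_num)
  have h2 : Integrable (fun q : F => ‖q‖ ^ 2) κ := hκ.integrable_norm_pow (by norm_num)
  have h3 : Integrable (fun q : F => ⟪c, q⟫) κ := h1.const_inner c
  have h4 : ∫ q, ⟪c, q⟫ ∂κ = 0 := by rw [integral_inner h1, h0, inner_zero_right]
  have : ∀ q : F, ‖q + c‖ ^ 2 = ‖q‖ ^ 2 + (2 * ⟪c, q⟫ + ‖c‖ ^ 2) := fun q => by
    rw [norm_add_sq_real, real_inner_comm]; ring
  simp_rw [this]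
  have h5 : Integrable (fun q : F => 2 * ⟪c, q⟫ + ‖c‖ ^ 2) κ :=
    (h3.const_mul 2).add (integrable_const _)
  rw [integral_add h2 h5, integral_add (h3.const_mul 2) (integrable_const _),
    integral_const_mul, h4]
  simp
-- The bathtub principle for trimmed integrals.
section Trimming

lemma integral_lt_of_ae_lt {X : Type*} [MeasurableSpace X] {μ : Measure X} [NeZero μ]
    {f g : X → ℝ} (hf : Integrable f μ) (hg : Integrable g μ) (h : ∀ᵐ x ∂μ, f x < g x) :
    ∫ x, f x ∂μ < ∫ x, g x ∂μ := by
  rw [← sub_pos, ← integral_sub hg hf, integral_pos_iff_support_of_nonneg_ae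
    (h.mono fun x hx => (sub_pos.2 hx).le) (hg.sub hf)]
  have h1 : Function.support (fun x => g x - f x) =ᵐ[μ] univ :=
    Filter.eventuallyEq_univ.2 (h.mono fun x hx => (sub_pos.2 hx).ne')
  rw [measure_congr h1]
  exact NeZero.pos _

variable {X : Type*} [MeasurableSpace X] {P : Measure X} [IsProbabilityMeasure P]

lemma integrable_max_sub {R : X → ℝ} (hR : Measurable R) (hR0 : ∀ x, 0 ≤ R x) (r : ℝ) :
    Integrable (fun x => max (r - R x) 0) P := by
  refine Integrable.of_bound (by fun_prop) |r| (Filter.Eventually.of_forall fun x => ?_)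
  rw [Real.norm_of_nonneg (le_max_right _ _)]
  exact max_le (by linarith [le_abs_self r, hR0 x]) (abs_nonneg r)

/-- Integrate `R ≥ r - (r - R)⁺` over `A`, then enlarge the domain of `(r - R)⁺` to the whole space.
Both losses vanish on a sublevel set at level `r`, which gives `setIntegral_eq_mul_sub`. -/
lemma setIntegral_ge_mul_sub {R : X → ℝ} (hR : Measurable R) (hR0 : ∀ x, 0 ≤ R x)
    (hRi : Integrable R P) {A : Set X} (r : ℝ) :
    r * P.real A - ∫ x, max (r - R x) 0 ∂P ≤ ∫ x in A, R x ∂P := by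
  have hi := integrable_max_sub (P := P) hR hR0 r
  have h1 : ∫ x in A, max (r - R x) 0 ∂P ≤ ∫ x, max (r - R x) 0 ∂P :=
    setIntegral_le_integral hi (Filter.Eventually.of_forall fun x => le_max_right _ _)
  have h2 : ∫ x in A, (r - max (r - R x) 0) ∂P ≤ ∫ x in A, R x ∂P :=
    integral_mono ((integrable_const _).sub hi.integrableOn) hRi.integrableOn fun x => by
      have := le_max_left (r - R x) 0
      simp only []
      linarith
  rw [integral_sub (integrable_const _) hi.integrableOn, setIntegral_const, smul_eq_mul] at h2
  linarith

lemma setIntegral_eq_mul_sub {R : X → ℝ} (hR : Measurable R) (hR0 : ∀ x, 0 ≤ R x)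
    {A : Set X} (hA : MeasurableSet A) {r : ℝ}
    (h1 : {x | R x < r} ⊆ A) (h2 : A ⊆ {x | R x ≤ r}) :
    ∫ x in A, R x ∂P = r * P.real A - ∫ x, max (r - R x) 0 ∂P := by
  have hi := integrable_max_sub (P := P) hR hR0 r
  have h3 : ∫ x in A, max (r - R x) 0 ∂P = ∫ x, max (r - R x) 0 ∂P :=
    setIntegral_eq_integral_of_forall_compl_eq_zero fun x hx => by
      have : ¬ R x < r := fun h => hx (h1 h)
      exact max_eq_right (by linarith)
  have h4 : ∫ x in A, R x ∂P = ∫ x in A, (r - max (r - R x) 0) ∂P :=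
    setIntegral_congr_fun hA fun x hx => by
      have : R x ≤ r := h2 hx
      rw [max_eq_left (by linarith)]; ring
  rw [h4, integral_sub (integrable_const _) hi.integrableOn, setIntegral_const, smul_eq_mul, h3]
  ring

/-- `A` consists of the points where `R` is smallest: up to ties, a sublevel set of `R`. -/
def IsSublevelLike (R : X → ℝ) (A : Set X) : Prop :=
  (∃ r, 0 ≤ r ∧ {x | R x < r} ⊆ A ∧ A ⊆ {x | R x ≤ r}) ∨ A = univ

lemma setIntegral_le_of_truncated_le {R R₀ : X → ℝ} (hR : Measurable R) (hR0 : ∀ x, 0 ≤ R x)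
    (hRi : Integrable R P) (hR₀ : Measurable R₀) (hR₀0 : ∀ x, 0 ≤ R₀ x)
    (htr : ∀ r, 0 < r → ∫ x, max (r - R x) 0 ∂P ≤ ∫ x, max (r - R₀ x) 0 ∂P)
    (hint : ∫ x, R₀ x ∂P ≤ ∫ x, R x ∂P)
    {A A₀ : Set X} (hA : MeasurableSet A) (hA₀ : MeasurableSet A₀) (hAA : P A = P A₀)
    (hsub : IsSublevelLike R₀ A₀) :
    ∫ x in A₀, R₀ x ∂P ≤ ∫ x in A, R x ∂P := by
  rcases hsub with ⟨r, hr, h1, h2⟩ | rfl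
  · rcases hr.eq_or_lt with rfl | hr
    · rw [setIntegral_eq_zero_of_forall_eq_zero fun x hx => le_antisymm (h2 hx) (hR₀0 x)]
      exact integral_nonneg hR0
    · rw [setIntegral_eq_mul_sub hR₀ hR₀0 hA₀ h1 h2]
      refine le_trans ?_ (setIntegral_ge_mul_sub hR hR0 hRi r)
      rw [measureReal_def, measureReal_def, hAA]
      linarith [htr r hr]
  · have h1 : A =ᵐ[P] univ := by
      rw [Filter.eventuallyEq_univ, mem_ae_iff, prob_compl_eq_zero_iff hA, hAA, measure_univ]
    rw [setIntegral_univ, setIntegral_congr_set h1, setIntegral_univ]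
    exact hint

lemma setIntegral_lt_of_truncated_lt {R R₀ : X → ℝ} (hR : Measurable R) (hR0 : ∀ x, 0 ≤ R x)
    (hRi : Integrable R P) (hR₀ : Measurable R₀) (hR₀0 : ∀ x, 0 ≤ R₀ x)
    (htr : ∀ r, 0 < r → ∫ x, max (r - R x) 0 ∂P < ∫ x, max (r - R₀ x) 0 ∂P)
    (hint : ∫ x, R₀ x ∂P < ∫ x, R x ∂P) (hpos : ∀ᵐ x ∂P, 0 < R x)
    {A A₀ : Set X} (hA : MeasurableSet A) (hA₀ : MeasurableSet A₀) (hAA : P A = P A₀)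
    (hA0 : P A ≠ 0) (hsub : IsSublevelLike R₀ A₀) :
    ∫ x in A₀, R₀ x ∂P < ∫ x in A, R x ∂P := by
  rcases hsub with ⟨r, hr, h1, h2⟩ | rfl
  -- At level `0` the optimal trimmed integral is zero and the truncation inequality says nothing;
  -- strictness then comes from `R > 0` almost everywhere.
  · rcases hr.eq_or_lt with rfl | hr
    · rw [setIntegral_eq_zero_of_forall_eq_zero fun x hx => le_antisymm (h2 hx) (hR₀0 x)]
      have : NeZero (P.restrict A) := ⟨by simpa [Measure.restrict_eq_zero] using hA0⟩
      simpa using integral_lt_of_ae_lt (integrable_zero _ _ _) hRi.integrableOn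
        (ae_restrict_of_ae hpos)
    · rw [setIntegral_eq_mul_sub hR₀ hR₀0 hA₀ h1 h2]
      refine lt_of_lt_of_le ?_ (setIntegral_ge_mul_sub hR hR0 hRi r)
      rw [measureReal_def, measureReal_def, hAA]
      linarith [htr r hr]
  · have h1 : A =ᵐ[P] univ := by
      rw [Filter.eventuallyEq_univ, mem_ae_iff, prob_compl_eq_zero_iff hA, hAA, measure_univ]
    rw [setIntegral_univ, setIntegral_congr_set h1, setIntegral_univ]
    exact hint

end Trimming

/-! ### Trimming over a product law, with the comparison made for each fixed first coordinate. -/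

section TrimmingProduct

variable {Z U : Type*} [MeasurableSpace Z] [MeasurableSpace U] {ν : Measure Z} {κ : Measure U}
  [IsProbabilityMeasure ν] [IsProbabilityMeasure κ]

lemma integral_prod_snd (f : U → ℝ) : ∫ p, f p.2 ∂(ν.prod κ) = ∫ u, f u ∂κ := by
  have := integral_fun_snd (μ := ν) (ν := κ) f
  simpa using this

variable {R : Z × U → ℝ} {R₀ : U → ℝ} (hR : Measurable R) (hR0 : ∀ x, 0 ≤ R x)
    (hRi : Integrable R (ν.prod κ)) (hR₀ : Measurable R₀) (hR₀0 : ∀ x, 0 ≤ R₀ x)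
    {A A₀ : Set (Z × U)} (hA : MeasurableSet A) (hA₀ : MeasurableSet A₀)
    (hAA : ν.prod κ A = ν.prod κ A₀)
    (hsub : IsSublevelLike (fun p => R₀ p.2) A₀)

include hR hR0 hRi hR₀ hR₀0 hA hA₀ hAA hsub

lemma trimmed_integral_le
    (htr : ∀ r, 0 < r → ∀ z, ∫ u, max (r - R (z, u)) 0 ∂κ ≤ ∫ u, max (r - R₀ u) 0 ∂κ)
    (hint : ∀ z, ∫ u, R₀ u ∂κ ≤ ∫ u, R (z, u) ∂κ) :
    ∫ p in A₀, R₀ p.2 ∂(ν.prod κ) ≤ ∫ p in A, R p ∂(ν.prod κ) := by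
  refine setIntegral_le_of_truncated_le hR hR0 hRi (hR₀.comp measurable_snd)
    (fun x => hR₀0 x.2) (fun r hr => ?_) ?_ hA hA₀ hAA hsub
  · have hi := integrable_max_sub (P := ν.prod κ) hR hR0 r
    simp only [Function.comp_apply]
    rw [integral_prod_snd (fun u => max (r - R₀ u) 0), integral_prod _ hi]
    calc _ ≤ ∫ z, (∫ u, max (r - R₀ u) 0 ∂κ) ∂ν :=
          integral_mono hi.integral_prod_left (integrable_const _) (htr r hr)
      _ = _ := by simp
  · simp only [Function.comp_apply]
    rw [integral_prod_snd, integral_prod _ hRi]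
    calc _ = ∫ z, (∫ u, R₀ u ∂κ) ∂ν := by simp
      _ ≤ _ := integral_mono (integrable_const _) hRi.integral_prod_left hint

lemma trimmed_integral_lt (hA0 : ν.prod κ A ≠ 0)
    (htr : ∀ r, 0 < r → ∀ᵐ z ∂ν, ∫ u, max (r - R (z, u)) 0 ∂κ < ∫ u, max (r - R₀ u) 0 ∂κ)
    (hint : ∀ᵐ z ∂ν, ∫ u, R₀ u ∂κ < ∫ u, R (z, u) ∂κ)
    (hpos : ∀ᵐ p ∂(ν.prod κ), 0 < R p) :
    ∫ p in A₀, R₀ p.2 ∂(ν.prod κ) < ∫ p in A, R p ∂(ν.prod κ) := by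
  refine setIntegral_lt_of_truncated_lt hR hR0 hRi (hR₀.comp measurable_snd)
    (fun x => hR₀0 x.2) (fun r hr => ?_) ?_ hpos hA hA₀ hAA hA0 hsub
  · have hi := integrable_max_sub (P := ν.prod κ) hR hR0 r
    simp only [Function.comp_apply]
    rw [integral_prod_snd (fun u => max (r - R₀ u) 0), integral_prod _ hi]
    calc _ < ∫ z, (∫ u, max (r - R₀ u) 0 ∂κ) ∂ν :=
          integral_lt_of_ae_lt hi.integral_prod_left (integrable_const _) (htr r hr)
      _ = _ := by simp
  · simp only [Function.comp_apply]
    rw [integral_prod_snd, integral_prod _ hRi]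
    calc _ = ∫ z, (∫ u, R₀ u ∂κ) ∂ν := by simp
      _ < _ := integral_lt_of_ae_lt (integrable_const _) hRi.integral_prod_left hint

end TrimmingProduct

/-! ### Trimming sets of exactly the prescribed mass. -/

section ExistenceOfTrimming

/-- `r` is the `α`-quantile of `R₀`, the infimum of the points where the distribution function
reaches `α`. The two bounds come from its left limit and its right continuity. -/
lemma exists_measureReal_lt_le {U : Type*} [MeasurableSpace U] {κ : Measure U}
    [IsProbabilityMeasure κ] {R₀ : U → ℝ} (hR₀ : Measurable R₀) (hR₀0 : ∀ x, 0 ≤ R₀ x)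
    {α : ℝ} (hα0 : 0 < α) (hα1 : α < 1) :
    ∃ r, 0 ≤ r ∧ κ.real {u | R₀ u < r} ≤ α ∧ α ≤ κ.real {u | R₀ u ≤ r} := by
  have : IsProbabilityMeasure (κ.map R₀) := Measure.isProbabilityMeasure_map hR₀.aemeasurable
  set F := cdf (κ.map R₀)
  have hF : ∀ x, F x = κ.real {u | R₀ u ≤ x} := fun x => by
    rw [cdf_eq_real, map_measureReal_apply hR₀ measurableSet_Iic]; rfl
  set s := {x | α ≤ F x}
  have hne : s.Nonempty := by
    have := (tendsto_cdf_atTop (κ.map R₀)).eventually (lt_mem_nhds hα1)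
    obtain ⟨x, hx⟩ := this.exists
    exact ⟨x, hx.le⟩
  have hlb : ∀ x ∈ s, 0 ≤ x := by
    intro x hx
    by_contra h
    have : {u | R₀ u ≤ x} = ∅ := by
      ext u; simp only [mem_ofPred_eq, mem_empty_iff_false, iff_false, not_le]
      linarith [hR₀0 u]
    have hx' : α ≤ F x := hx
    rw [hF, this, measureReal_empty] at hx'
    linarith
  have hbdd : BddBelow s := ⟨0, hlb⟩
  refine ⟨sInf s, le_csInf hne hlb, ?_, ?_⟩
  · have hlim : Filter.Tendsto F (nhdsWithin (sInf s) (Iio (sInf s)))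
        (nhds (κ.real {u | R₀ u < sInf s})) := by
      have h1 := F.mono.tendsto_leftLim (sInf s)
      convert h1 using 2
      have h2 : (κ.map R₀) (Iio (sInf s)) = ENNReal.ofReal (Function.leftLim F (sInf s)) := by
        rw [← measure_cdf (κ.map R₀), StieltjesFunction.measure_Iio _ (tendsto_cdf_atBot _)]
        simp [F]
      rw [measureReal_def]
      have h3 : κ {u | R₀ u < sInf s} = (κ.map R₀) (Iio (sInf s)) := by
        rw [Measure.map_apply hR₀ measurableSet_Iio]; rfl
      rw [h3, h2, ENNReal.toReal_ofReal]
      exact F.mono.le_leftLim (show sInf s - 1 < sInf s by linarith) |>.trans' (cdf_nonneg _ _)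
    refine le_of_tendsto hlim ?_
    filter_upwards [self_mem_nhdsWithin] with x hx
    by_contra h
    exact absurd (csInf_le hbdd (show x ∈ s from (not_le.1 h).le)) (not_le.2 hx)
  · rw [← hF]
    have hlim : Filter.Tendsto F (nhdsWithin (sInf s) (Ioi (sInf s))) (nhds (F (sInf s))) :=
      (F.right_continuous (sInf s)).mono_left (nhdsWithin_mono _ Ioi_subset_Ici_self)
    refine ge_of_tendsto hlim ?_
    filter_upwards [self_mem_nhdsWithin] with x hx
    obtain ⟨y, hy, hyx⟩ := (csInf_lt_iff hbdd hne).1 hx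
    exact hy.trans (F.mono hyx.le)

lemma exists_measureReal_le_eq {Z : Type*} [MeasurableSpace Z] {ν : Measure Z}
    [IsProbabilityMeasure ν] {N : Z → ℝ} (hN : Measurable N) (hatom : ∀ x, ν {z | N z = x} = 0)
    {θ : ℝ} (h0 : 0 < θ) (h1 : θ < 1) : ∃ τ, ν.real {z | N z ≤ τ} = θ := by
  have : IsProbabilityMeasure (ν.map N) := Measure.isProbabilityMeasure_map hN.aemeasurable
  have hna : ∀ x, (ν.map N) {x} = 0 := fun x => by
    rw [Measure.map_apply hN (measurableSet_singleton x)]; exact hatom x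
  set F := cdf (ν.map N)
  have hF : ∀ x, F x = ν.real {u | N u ≤ x} := fun x => by
    rw [cdf_eq_real, map_measureReal_apply hN measurableSet_Iic]; rfl
  have hcont : Continuous F := by
    rw [continuous_iff_continuousAt]
    intro x
    rw [F.mono.continuousAt_iff_leftLim_eq_rightLim]
    have h2 := hna x
    rw [← measure_cdf (ν.map N), StieltjesFunction.measure_singleton, ENNReal.ofReal_eq_zero] at h2
    rw [StieltjesFunction.rightLim_eq]
    exact le_antisymm (F.mono.leftLim_le le_rfl) (by linarith)
  obtain ⟨x, hx⟩ := ((tendsto_cdf_atBot (ν.map N)).eventually (gt_mem_nhds h0)).exists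
  obtain ⟨y, hy⟩ := ((tendsto_cdf_atTop (ν.map N)).eventually (lt_mem_nhds h1)).exists
  obtain ⟨τ, hτ⟩ := mem_range_of_exists_le_of_exists_ge hcont ⟨x, hx.le⟩ ⟨y, hy.le⟩
  exact ⟨τ, by rw [← hF, hτ]⟩

/-- `R₀` may have an atom at its quantile, for instance when the error vanishes; the atom is then
cut to size with the atomless `N`. Describing the set by `D` makes it depend on the first coordinate
through `N` only, and this later yields its symmetry. -/
lemma exists_trimming {Z U : Type*} [MeasurableSpace Z] [MeasurableSpace U] {ν : Measure Z}
    {κ : Measure U} [IsProbabilityMeasure ν] [IsProbabilityMeasure κ]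
    {N : Z → ℝ} (hN : Measurable N) (hatom : ∀ x, ν {z | N z = x} = 0)
    {R₀ : U → ℝ} (hR₀ : Measurable R₀) (hR₀0 : ∀ x, 0 ≤ R₀ x)
    {α : ℝ} (hα0 : 0 < α) (hα1 : α ≤ 1) :
    ∃ D : Set (ℝ × ℝ), MeasurableSet D ∧
      ν.prod κ {p | (N p.1, R₀ p.2) ∈ D} = ENNReal.ofReal α ∧
      IsSublevelLike (fun p : Z × U => R₀ p.2) {p | (N p.1, R₀ p.2) ∈ D} := by
  rcases hα1.eq_or_lt with rfl | hα1
  · exact ⟨univ, MeasurableSet.univ, by simp, Or.inr (by simp)⟩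
  obtain ⟨r, hr, h1, h2⟩ := exists_measureReal_lt_le hR₀ hR₀0 (κ := κ) hα0 hα1
  have hm1 : MeasurableSet {u | R₀ u < r} := measurableSet_lt hR₀ measurable_const
  have hm2 : MeasurableSet {u | R₀ u ≤ r} := measurableSet_le hR₀ measurable_const
  have hm3 : MeasurableSet {u | R₀ u = r} := measurableSet_eq_fun hR₀ measurable_const
  rcases h1.eq_or_lt with h1 | h1
  · refine ⟨univ ×ˢ Iio r, MeasurableSet.univ.prod measurableSet_Iio, ?_, Or.inl ⟨r, hr, ?_, ?_⟩⟩
    · have : {p : Z × U | (N p.1, R₀ p.2) ∈ (univ : Set ℝ) ×ˢ Iio r} = univ ×ˢ {u | R₀ u < r} := by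
        ext p; simp
      rw [this, Measure.prod_prod, measure_univ, one_mul, ← h1, ofReal_measureReal]
    · intro p hp; simpa using hp
    · intro p hp
      have : R₀ p.2 < r := by simpa using hp
      exact this.le
  rcases h2.eq_or_lt with h2 | h2
  · refine ⟨univ ×ˢ Iic r, MeasurableSet.univ.prod measurableSet_Iic, ?_, Or.inl ⟨r, hr, ?_, ?_⟩⟩
    · have : {p : Z × U | (N p.1, R₀ p.2) ∈ (univ : Set ℝ) ×ˢ Iic r} = univ ×ˢ {u | R₀ u ≤ r} := by
        ext p; simp
      rw [this, Measure.prod_prod, measure_univ, one_mul, h2, ofReal_measureReal]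
    · intro p hp
      have : R₀ p.2 < r := hp
      simpa using this.le
    · intro p hp; simpa using hp
  have hsplit : κ.real {u | R₀ u ≤ r} = κ.real {u | R₀ u < r} + κ.real {u | R₀ u = r} := by
    rw [← measureReal_union _ hm3]
    · congr 1; ext u; simp [le_iff_lt_or_eq]
    · rw [Set.disjoint_left]; intro u hu hu'; exact absurd hu' (ne_of_lt hu)
  have hpos : 0 < κ.real {u | R₀ u = r} := by linarith
  -- The fraction of the atom needed to raise the mass below level `r` to `α`.
  obtain ⟨τ, hτ⟩ := exists_measureReal_le_eq hN hatom
    (θ := (α - κ.real {u | R₀ u < r}) / κ.real {u | R₀ u = r})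
    (div_pos (by linarith) hpos) ((div_lt_one hpos).2 (by linarith))
  refine ⟨univ ×ˢ Iio r ∪ Iic τ ×ˢ {r}, (MeasurableSet.univ.prod measurableSet_Iio).union
    (measurableSet_Iic.prod (measurableSet_singleton r)), ?_, Or.inl ⟨r, hr, ?_, ?_⟩⟩
  · have : {p : Z × U | (N p.1, R₀ p.2) ∈ (univ : Set ℝ) ×ˢ Iio r ∪ Iic τ ×ˢ {r}} =
        univ ×ˢ {u | R₀ u < r} ∪ {z | N z ≤ τ} ×ˢ {u | R₀ u = r} := by
      ext p; simp
    rw [this, measure_union _ ((measurableSet_le hN measurable_const).prod hm3),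
      Measure.prod_prod, Measure.prod_prod, measure_univ, one_mul,
      ← ofReal_measureReal, ← ofReal_measureReal (s := {z | N z ≤ τ}),
      ← ofReal_measureReal (s := {u | R₀ u = r}),
      ← ENNReal.ofReal_mul measureReal_nonneg,
      ← ENNReal.ofReal_add measureReal_nonneg (by positivity), hτ]
    · congr 1; field_simp; ring
    · rw [Set.disjoint_left]
      rintro p ⟨-, hp⟩ ⟨-, hp'⟩
      exact absurd hp' (ne_of_lt hp)
  · intro p hp
    left; exact ⟨mem_univ _, hp⟩
  · rintro p (⟨-, hp⟩ | ⟨-, hp⟩)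
    · exact (show R₀ p.2 < r from hp).le
    · exact (show R₀ p.2 = r from hp).le

end ExistenceOfTrimming

/-! ### Second moment matrices, their determinant and trace. -/

section MomentMatrix

variable {X : Type*} [MeasurableSpace X] {K : ℕ}

/-- The matrix of second moments `∫ yₖ yₗ` of a random vector. -/
noncomputable def momentMatrix (P : Measure X) (y : X → EuclideanSpace ℝ (Fin K)) :
    Matrix (Fin K) (Fin K) ℝ :=
  Matrix.of fun k l => ∫ x, y x k * y x l ∂P

variable {P : Measure X} {y : X → EuclideanSpace ℝ (Fin K)}

lemma memLp_coord {X : Type*} [MeasurableSpace X] {P : Measure X} {K : ℕ}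
    {y : X → EuclideanSpace ℝ (Fin K)} (hy : MemLp y 2 P) (k : Fin K) :
    MemLp (fun x => y x k) 2 P :=
  (EuclideanSpace.proj (𝕜 := ℝ) k).comp_memLp' hy

lemma integrable_coord_mul (hy : MemLp y 2 P) (k l : Fin K) :
    Integrable (fun x => y x k * y x l) P :=
  (memLp_coord hy k).integrable_mul (memLp_coord hy l)

lemma trace_momentMatrix (hy : MemLp y 2 P) :
    (momentMatrix P y).trace = ∫ x, ‖y x‖ ^ 2 ∂P := by
  simp only [Matrix.trace, momentMatrix, Matrix.diag_apply, Matrix.of_apply]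
  rw [← integral_finsetSum _ fun k _ => integrable_coord_mul hy k k]
  simp_rw [EuclideanSpace.real_norm_sq_eq, sq]

lemma momentMatrix_toEuclideanLin (hy : MemLp y 2 P) (W : Matrix (Fin K) (Fin K) ℝ) :
    momentMatrix P (fun x => Matrix.toEuclideanLin W (y x)) =
      W * momentMatrix P y * W.transpose := by
  ext k l
  simp only [momentMatrix, Matrix.of_apply, Matrix.mul_apply, Matrix.transpose_apply,
    Finset.sum_mul]
  have h1 : ∀ x, (Matrix.toEuclideanLin W (y x)) k * (Matrix.toEuclideanLin W (y x)) l =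
      ∑ j, ∑ i, W k i * W l j * (y x i * y x j) := by
    intro x
    simp only [Matrix.toLpLin_apply, Matrix.mulVec, dotProduct]
    rw [Finset.sum_mul_sum, Finset.sum_comm]
    exact Finset.sum_congr rfl fun j _ => Finset.sum_congr rfl fun i _ => by ring
  simp_rw [h1]
  rw [integral_finsetSum _ fun j _ => integrable_finsetSum _ fun i _ =>
    (integrable_coord_mul hy i j).const_mul _]
  refine Finset.sum_congr rfl fun j _ => ?_
  rw [integral_finsetSum _ fun i _ => (integrable_coord_mul hy i j).const_mul _]
  refine Finset.sum_congr rfl fun i _ => ?_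
  rw [integral_const_mul]
  ring

lemma dotProduct_momentMatrix_mulVec (hy : MemLp y 2 P) (v : Fin K → ℝ) :
    v ⬝ᵥ (momentMatrix P y).mulVec v = ∫ x, (∑ k, v k * y x k) ^ 2 ∂P := by
  have h1 : ∀ x, (∑ k, v k * y x k) ^ 2 = ∑ k, ∑ l, v k * v l * (y x k * y x l) := by
    intro x
    rw [sq, Finset.sum_mul_sum]
    exact Finset.sum_congr rfl fun j _ => Finset.sum_congr rfl fun i _ => by ring
  simp_rw [h1]
  rw [integral_finsetSum _ fun j _ => integrable_finsetSum _ fun i _ =>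
    (integrable_coord_mul hy j i).const_mul _]
  simp only [dotProduct, Matrix.mulVec, Finset.mul_sum, momentMatrix, Matrix.of_apply]
  refine Finset.sum_congr rfl fun j _ => ?_
  rw [integral_finsetSum _ fun i _ => (integrable_coord_mul hy j i).const_mul _]
  refine Finset.sum_congr rfl fun i _ => ?_
  rw [integral_const_mul]
  ring

lemma isHermitian_momentMatrix : (momentMatrix P y).IsHermitian := by
  ext k l
  simp [momentMatrix, mul_comm]

lemma posSemidef_momentMatrix (hy : MemLp y 2 P) : (momentMatrix P y).PosSemidef := by
  rw [Matrix.posSemidef_iff_dotProduct_mulVec]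
  refine ⟨isHermitian_momentMatrix, fun v => ?_⟩
  rw [star_trivial, dotProduct_momentMatrix_mulVec hy]
  exact integral_nonneg fun _ => sq_nonneg _

lemma posDef_momentMatrix [NeZero P] (hy : MemLp y 2 P)
    (hne : ∀ v : Fin K → ℝ, v ≠ 0 → ∀ᵐ x ∂P, ∑ k, v k * y x k ≠ 0) :
    (momentMatrix P y).PosDef := by
  rw [Matrix.posDef_iff_dotProduct_mulVec]
  refine ⟨isHermitian_momentMatrix, fun v hv => ?_⟩
  rw [star_trivial, dotProduct_momentMatrix_mulVec hy]
  have hi : Integrable (fun x => (∑ k, v k * y x k) ^ 2) P :=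
    (memLp_finsetSum _ fun k _ => (memLp_coord hy k).const_mul (v k)).integrable_sq
  simpa using integral_lt_of_ae_lt (integrable_zero _ _ _) hi
    ((hne v hv).mono fun x hx => sq_pos_of_ne_zero hx)

open scoped MatrixOrder in
-- `W` is `N^{-1/2}` times the scalar `s` that gives it determinant one. It puts `N` in the equality
-- case of the inequality between determinant and trace, so a bound on a trace becomes a bound on
-- `N.det`.
lemma exists_normalizing_matrix {N : Matrix (Fin K) (Fin K) ℝ} (hN : N.PosDef) (hK : 0 < K) :
    ∃ (W : Matrix (Fin K) (Fin K) ℝ) (s : ℝ), W.det = 1 ∧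
      W * N * W.transpose = s ^ 2 • (1 : Matrix (Fin K) (Fin K) ℝ) ∧ N.det = (s ^ 2) ^ K := by
  set Q := CFC.sqrt N
  have hQQ : Q * Q = N := CFC.sqrt_mul_sqrt_self _ hN.posSemidef.nonneg
  have hQT : Q.transpose = Q := by
    have : IsSelfAdjoint Q := (CFC.sqrt_nonneg N).isSelfAdjoint
    simpa [IsSelfAdjoint, Matrix.star_eq_conjTranspose] using this
  have hdQ : 0 < Q.det := by
    have h1 : 0 ≤ Q.det := (Matrix.nonneg_iff_posSemidef.1 (CFC.sqrt_nonneg N)).det_nonneg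
    refine lt_of_le_of_ne h1 fun h => ?_
    have := hN.det_pos
    rw [← hQQ, Matrix.det_mul, ← h] at this
    simp at this
  have hQu : IsUnit Q.det := isUnit_iff_ne_zero.2 hdQ.ne'
  set s := Q.det ^ ((1 : ℝ) / K)
  have hsK : s ^ K = Q.det := by
    simp only [s]
    rw [← Real.rpow_natCast, ← Real.rpow_mul hdQ.le]
    have : (K : ℝ) ≠ 0 := by exact_mod_cast hK.ne'
    rw [one_div_mul_cancel this, Real.rpow_one]
  refine ⟨s • Q⁻¹, s, ?_, ?_, ?_⟩
  · rw [Matrix.det_smul, Fintype.card_fin, hsK, Matrix.det_nonsing_inv]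
    exact Ring.mul_inverse_cancel _ hQu
  · rw [Matrix.transpose_smul, Matrix.transpose_nonsing_inv, hQT, ← hQQ]
    simp only [Matrix.smul_mul, Matrix.mul_smul, smul_smul]
    rw [← Matrix.mul_assoc, Matrix.nonsing_inv_mul _ hQu, Matrix.one_mul,
      Matrix.mul_nonsing_inv _ hQu, sq]
  · rw [← hQQ, Matrix.det_mul, ← hsK]; ring

/-- The inequality of arithmetic and geometric means for the eigenvalues. -/
lemma det_le_trace_div_pow {N : Matrix (Fin K) (Fin K) ℝ} (hN : N.PosSemidef) (hK : 0 < K) :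
    N.det ≤ (N.trace / K) ^ K := by
  have hK' : (0 : ℝ) < K := by exact_mod_cast hK
  rw [hN.1.det_eq_prod_eigenvalues, hN.1.trace_eq_sum_eigenvalues]
  simp only [RCLike.ofReal_real_eq_id, id_eq]
  set z := hN.1.eigenvalues
  have hz : ∀ i, 0 ≤ z i := hN.eigenvalues_nonneg
  have h := Real.geom_mean_le_arith_mean_weighted Finset.univ (fun _ : Fin K => (1 : ℝ) / K) z
    (fun _ _ => by positivity) (by simp [hK'.ne']) (fun i _ => hz i)
  rw [Real.finsetProd_rpow _ _ (fun i _ => hz i), ← Finset.mul_sum] at h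
  have hp : 0 ≤ ∏ i, z i := Finset.prod_nonneg fun i _ => hz i
  calc ∏ i, z i = ((∏ i, z i) ^ ((1 : ℝ) / K)) ^ K := by
        rw [← Real.rpow_natCast, ← Real.rpow_mul hp, one_div_mul_cancel hK'.ne', Real.rpow_one]
    _ ≤ (1 / K * ∑ i, z i) ^ K := pow_le_pow_left₀ (Real.rpow_nonneg hp _) h K
    _ = _ := by rw [one_div_mul_eq_div]

end MomentMatrix

/-! ### Affine hyperplanes are null for laws with a density. -/

section NullSets

variable {E : Type*} [NormedAddCommGroup E] [InnerProductSpace ℝ E] [FiniteDimensional ℝ E]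
  [MeasurableSpace E] [BorelSpace E]

lemma map_inner_absolutelyContinuous {ν : Measure E} (hν : ν ≪ volume) {x : E} (hx : x ≠ 0) :
    ν.map (fun z => ⟪x, z⟫) ≪ volume := by
  refine (hν.map (by fun_prop)).trans ?_
  have hsurj : Function.Surjective (innerₛₗ ℝ x) := by
    refine LinearMap.surjective fun h => hx ?_
    have := LinearMap.congr_fun h x
    simpa using this
  obtain ⟨c, -, hc⟩ := (innerₛₗ ℝ x).exists_map_addHaar_eq_smul_addHaar volume volume hsurj
  have : (fun z => ⟪x, z⟫) = ⇑(innerₛₗ ℝ x) := rfl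
  rw [this, hc]
  exact Measure.smul_absolutelyContinuous

lemma ae_inner_ne {ν : Measure E} (hν : ν ≪ volume) {x : E} (hx : x ≠ 0) (t : ℝ) :
    ∀ᵐ z ∂ν, ⟪x, z⟫ ≠ t := by
  have h := map_inner_absolutelyContinuous hν hx (Real.volume_singleton (a := t))
  rw [Measure.map_apply (by fun_prop) (measurableSet_singleton t)] at h
  rw [ae_iff]
  simp only [not_not]
  exact h

end NullSets

/-! ### The finite-dimensional linear model and the trace criterion. -/

section RegressionCore

variable {M K : ℕ}

/-- The product `z D` of a row vector with a matrix, as a linear map of Euclidean spaces. -/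
noncomputable def rowMul (D : Matrix (Fin M) (Fin K) ℝ) :
    EuclideanSpace ℝ (Fin M) →L[ℝ] EuclideanSpace ℝ (Fin K) :=
  LinearMap.toContinuousLinearMap (Matrix.toEuclideanLin D.transpose)

lemma rowMul_apply (D : Matrix (Fin M) (Fin K) ℝ) (z : EuclideanSpace ℝ (Fin M)) (k : Fin K) :
    rowMul D z k = ∑ m, z m * D m k := by
  simp [rowMul, Matrix.toLpLin_apply, Matrix.mulVec, dotProduct, mul_comm]

lemma rowMul_sub (D D' : Matrix (Fin M) (Fin K) ℝ) (z : EuclideanSpace ℝ (Fin M)) :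
    rowMul (D - D') z = rowMul D z - rowMul D' z := by
  ext k
  simp [rowMul_apply, mul_sub]

lemma ae_rowMul_ne {ν : Measure (EuclideanSpace ℝ (Fin M))} (hν : ν ≪ volume)
    {D : Matrix (Fin M) (Fin K) ℝ} (hD : D ≠ 0) (v : EuclideanSpace ℝ (Fin K)) :
    ∀ᵐ z ∂ν, rowMul D z ≠ v := by
  obtain ⟨k, hk⟩ : ∃ k, WithLp.toLp 2 (fun m => D m k) ≠ (0 : EuclideanSpace ℝ (Fin M)) := by
    by_contra! h
    refine hD ?_
    ext m k
    simpa using congrArg (fun x : EuclideanSpace ℝ (Fin M) => x m) (h k)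
  filter_upwards [ae_inner_ne hν hk (v k)] with z hz h
  apply hz
  rw [← h, rowMul_apply, PiLp.inner_apply]
  simp [mul_comm]

/-- The map `(z, u) ↦ (z, z B + T u)` from predictors and errors to observations. -/
noncomputable def regMap (B : Matrix (Fin M) (Fin K) ℝ)
    (T : EuclideanSpace ℝ (Fin K) ≃L[ℝ] EuclideanSpace ℝ (Fin K))
    (p : EuclideanSpace ℝ (Fin M) × EuclideanSpace ℝ (Fin K)) :
    EuclideanSpace ℝ (Fin M) × EuclideanSpace ℝ (Fin K) :=
  (p.1, rowMul B p.1 + T p.2)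

lemma measurable_regMap (B : Matrix (Fin M) (Fin K) ℝ)
    (T : EuclideanSpace ℝ (Fin K) ≃L[ℝ] EuclideanSpace ℝ (Fin K)) : Measurable (regMap B T) := by
  unfold regMap
  fun_prop

lemma regResidual_regMap (B B' : Matrix (Fin M) (Fin K) ℝ)
    (T : EuclideanSpace ℝ (Fin K) ≃L[ℝ] EuclideanSpace ℝ (Fin K))
    (p : EuclideanSpace ℝ (Fin M) × EuclideanSpace ℝ (Fin K)) (k : Fin K) :
    regResidual B' (regMap B T p) k = T (p.2 + T.symm (rowMul (B - B') p.1)) k := by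
  rw [map_add, T.apply_symm_apply, rowMul_sub]
  simp only [regResidual, regMap, PiLp.add_apply, PiLp.sub_apply, rowMul_apply]
  ring

lemma measurable_regResidual (B : Matrix (Fin M) (Fin K) ℝ) (k : Fin K) :
    Measurable fun p => regResidual B p k := by
  unfold regResidual
  fun_prop

variable {ν : Measure (EuclideanSpace ℝ (Fin M))} {κ : Measure (EuclideanSpace ℝ (Fin K))}
  {α : ℝ} {B B' : Matrix (Fin M) (Fin K) ℝ}
  {T : EuclideanSpace ℝ (Fin K) ≃L[ℝ] EuclideanSpace ℝ (Fin K)}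
  {A : Set (EuclideanSpace ℝ (Fin M) × EuclideanSpace ℝ (Fin K))}

lemma memLp_add_rowMul [IsProbabilityMeasure ν] [IsProbabilityMeasure κ]
    (hν2 : MemLp id 2 ν) (hκ2 : MemLp id 2 κ)
    (L : EuclideanSpace ℝ (Fin M) →L[ℝ] EuclideanSpace ℝ (Fin K)) :
    MemLp (fun p : EuclideanSpace ℝ (Fin M) × EuclideanSpace ℝ (Fin K) => p.2 + L p.1) 2
      (ν.prod κ) :=
  (hκ2.comp_snd ν).add (L.comp_memLp' (hν2.comp_fst κ))

lemma memLp_id_map_regMap [IsProbabilityMeasure ν] [IsProbabilityMeasure κ]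
    (hν2 : MemLp id 2 ν) (hκ2 : MemLp id 2 κ) :
    MemLp (fun p => p) 2 ((ν.prod κ).map (regMap B T)) := by
  refine (memLp_map_measure_iff (by fun_prop) (measurable_regMap B T).aemeasurable).2 ?_
  refine MemLp.of_fst_snd ⟨hν2.comp_fst κ, ?_⟩
  exact ((rowMul B).comp_memLp' (hν2.comp_fst κ)).add
    (T.toContinuousLinearMap.comp_memLp' (hκ2.comp_snd ν))

lemma trimmedScatter_map_regMap (hA : MeasurableSet A) :
    trimmedScatter α ((ν.prod κ).map (regMap B T)) A B' =
      α⁻¹ • momentMatrix ((ν.prod κ).restrict (regMap B T ⁻¹' A))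
        (fun p => T (p.2 + T.symm (rowMul (B - B') p.1))) := by
  ext k l
  simp only [trimmedScatter, Matrix.of_apply, Matrix.smul_apply, momentMatrix, smul_eq_mul]
  have hm : Measurable fun p => regResidual B' p k * regResidual B' p l :=
    (measurable_regResidual B' k).mul (measurable_regResidual B' l)
  rw [setIntegral_map hA hm.aestronglyMeasurable (measurable_regMap B T).aemeasurable]
  simp_rw [regResidual_regMap]

/-- The candidate optimum: the smallest standardised errors are kept, ties being broken by `‖z‖`.
The true `B` satisfies the normal equations on it because set and law are both invariant under `z ↦
-z`. -/
lemma exists_isTrimmingSet [IsProbabilityMeasure ν] [IsProbabilityMeasure κ] (hM : 0 < M)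
    (hν : ν ≪ volume) (hsym : ν.map (fun z => -z) = ν)
    (hν2 : MemLp id 2 ν) (hκ2 : MemLp id 2 κ) (hα0 : 0 < α) (hα1 : α ≤ 1)
    (B : Matrix (Fin M) (Fin K) ℝ)
    (T : EuclideanSpace ℝ (Fin K) ≃L[ℝ] EuclideanSpace ℝ (Fin K)) :
    ∃ A, IsTrimmingSet α ((ν.prod κ).map (regMap B T)) A ∧
      IsLSFit ((ν.prod κ).map (regMap B T)) A B ∧
      IsSublevelLike (fun p => ‖p.2‖ ^ 2) (regMap B T ⁻¹' A) := by
  have : Nonempty (Fin M) := ⟨⟨0, hM⟩⟩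
  have : Nontrivial (EuclideanSpace ℝ (Fin M)) := inferInstance
  have hatom : ∀ x, ν {z | ‖z‖ = x} = 0 := fun x => hν <| by
    have := Measure.addHaar_sphere (volume : Measure (EuclideanSpace ℝ (Fin M))) 0 x
    convert this using 2
    ext z; simp
  obtain ⟨D, hD, hmass, hsub⟩ := exists_trimming (ν := ν) (κ := κ) (N := fun z => ‖z‖)
    (by fun_prop) hatom (R₀ := fun u => ‖u‖ ^ 2) (by fun_prop) (fun _ => by positivity) hα0 hα1
  -- The error is recovered from the observation `(z, w)` as `T⁻¹ (w - z B)`.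
  set g : EuclideanSpace ℝ (Fin M) × EuclideanSpace ℝ (Fin K) → ℝ × ℝ :=
    fun p => (‖p.1‖, ‖T.symm (p.2 - rowMul B p.1)‖ ^ 2)
  have hg : Measurable g := by fun_prop
  have hpre : regMap B T ⁻¹' (g ⁻¹' D) = {p | (‖p.1‖, ‖p.2‖ ^ 2) ∈ D} := by
    ext p
    simp [g, regMap]
  have hmA : MeasurableSet (g ⁻¹' D) := hg hD
  refine ⟨g ⁻¹' D, ⟨hmA, ?_, ?_⟩, fun m k => ?_, ?_⟩
  · rw [Measure.map_apply (measurable_regMap B T) hmA, hpre, hmass]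
  · exact (memLp_id_map_regMap hν2 hκ2).mono_measure Measure.restrict_le_self
  · have hm : Measurable fun p : EuclideanSpace ℝ (Fin M) × EuclideanSpace ℝ (Fin K) =>
        p.1 m * regResidual B p k :=
      Measurable.mul (by fun_prop) (measurable_regResidual B k)
    rw [setIntegral_map hmA hm.aestronglyMeasurable (measurable_regMap B T).aemeasurable]
    simp_rw [regResidual_regMap]
    have h0 : ∀ z, rowMul (B - B) z = 0 := fun z => by rw [rowMul_sub, sub_self]
    simp_rw [h0, map_zero, add_zero]
    rw [hpre]
    set A₀ := {p : EuclideanSpace ℝ (Fin M) × EuclideanSpace ℝ (Fin K) | (‖p.1‖, ‖p.2‖ ^ 2) ∈ D}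
    have hmp : MeasurePreserving (fun p : EuclideanSpace ℝ (Fin M) × EuclideanSpace ℝ (Fin K) =>
        (-p.1, p.2)) (ν.prod κ) (ν.prod κ) :=
      MeasurePreserving.prod ⟨measurable_neg, hsym⟩ (MeasurePreserving.id κ)
    have hemb : MeasurableEmbedding (fun p : EuclideanSpace ℝ (Fin M) ×
        EuclideanSpace ℝ (Fin K) => (-p.1, p.2)) :=
      ((MeasurableEquiv.neg (EuclideanSpace ℝ (Fin M))).prodCongr
        (MeasurableEquiv.refl (EuclideanSpace ℝ (Fin K)))).measurableEmbedding
    -- The integrand is odd in `z`, so its integral over the invariant set equals its own negative.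
    have h := hmp.setIntegral_preimage_emb hemb (fun p => p.1 m * T p.2 k) A₀
    have hpre' : (fun p : EuclideanSpace ℝ (Fin M) × EuclideanSpace ℝ (Fin K) =>
        (-p.1, p.2)) ⁻¹' A₀ = A₀ := by
      ext p; simp [A₀]
    rw [hpre'] at h
    simp only [PiLp.neg_apply, neg_mul, integral_neg] at h
    simp only [regMap]
    linarith
  · rw [hpre]; exact hsub

lemma isTrimmingSet_preimage_eq {J : Measure (EuclideanSpace ℝ (Fin M) × EuclideanSpace ℝ (Fin K))}
    (hJ : J = (ν.prod κ).map (regMap B T)) (hA : IsTrimmingSet α J A) :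
    ν.prod κ (regMap B T ⁻¹' A) = ENNReal.ofReal α := by
  rw [← hA.mass, hJ, Measure.map_apply (measurable_regMap B T) hA.measurableSet]

lemma ae_prod_ne_zero [IsProbabilityMeasure ν] [IsProbabilityMeasure κ] (hν : ν ≪ volume)
    {D : Matrix (Fin M) (Fin K) ℝ} (hD : D ≠ 0) :
    ∀ᵐ p ∂(ν.prod κ), p.2 + T.symm (rowMul D p.1) ≠ 0 := by
  have hm : MeasurableSet {p : EuclideanSpace ℝ (Fin M) × EuclideanSpace ℝ (Fin K) |
      p.2 + T.symm (rowMul D p.1) ≠ 0} :=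
    (measurableSet_eq_fun (by fun_prop) measurable_const).compl
  -- The error is fixed and `z` varies, since only `z` is known to have a density.
  rw [← Measure.prod_swap, ae_map_iff measurable_swap.aemeasurable hm]
  refine (Measure.ae_prod_iff_ae_ae (measurable_swap hm)).2 ?_
  refine Filter.Eventually.of_forall fun u => ?_
  filter_upwards [ae_rowMul_ne hν hD (-T u)] with z hz h
  apply hz
  have h1 : T (u + T.symm (rowMul D z)) = 0 := by
    rw [show u + T.symm (rowMul D z) = 0 from h, map_zero]
  rw [map_add, T.apply_symm_apply] at h1
  exact eq_neg_of_add_eq_zero_right h1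

section Trace

variable [IsProbabilityMeasure ν] [IsProbabilityMeasure κ]
  {J : Measure (EuclideanSpace ℝ (Fin M) × EuclideanSpace ℝ (Fin K))}

lemma trace_trimmedScatter (hν2 : MemLp id 2 ν) (hκ2 : MemLp id 2 κ) (hA : MeasurableSet A) :
    (trimmedScatter α ((ν.prod κ).map (regMap B (ContinuousLinearEquiv.refl ℝ _))) A B').trace =
      α⁻¹ * ∫ p in regMap B (ContinuousLinearEquiv.refl ℝ _) ⁻¹' A,
        ‖p.2 + rowMul (B - B') p.1‖ ^ 2 ∂(ν.prod κ) := by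
  rw [trimmedScatter_map_regMap hA, Matrix.trace_smul, smul_eq_mul, trace_momentMatrix]
  · rfl
  · exact (memLp_add_rowMul hν2 hκ2 (rowMul (B - B'))).mono_measure Measure.restrict_le_self

/-- Least trimmed squares recovers the coefficient matrix of a linear model with a predictor that
is symmetric and has a density, and an error whose truncated squared norm is smallest when
centred. -/
theorem isMLTS_trace_iff (hM : 0 < M) (hν : ν ≪ volume) (hsym : ν.map (fun z => -z) = ν)
    (hν2 : MemLp id 2 ν) (hκ2 : MemLp id 2 κ) (hκ0 : ∫ q, q ∂κ = 0)
    (hκA : ∀ c : EuclideanSpace ℝ (Fin K), c ≠ 0 → ∀ r : ℝ, 0 < r →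
      ∫ q, max (r - ‖q + c‖ ^ 2) 0 ∂κ < ∫ q, max (r - ‖q‖ ^ 2) 0 ∂κ)
    (hα0 : 0 < α) (hα1 : α ≤ 1)
    (hJ : J = (ν.prod κ).map fun p => (p.1, rowMul B p.1 + p.2)) :
    IsMLTS Matrix.trace α J B' ↔ B' = B := by
  set I := ContinuousLinearEquiv.refl ℝ (EuclideanSpace ℝ (Fin K))
  replace hJ : J = (ν.prod κ).map (regMap B I) := hJ
  obtain ⟨A₀, hA₀, hfit, hsub⟩ := exists_isTrimmingSet hM hν hsym hν2 hκ2 hα0 hα1 B I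
  rw [← hJ] at hA₀ hfit
  have hP₀ := isTrimmingSet_preimage_eq hJ hA₀
  have hm₀ : MeasurableSet (regMap B I ⁻¹' A₀) := measurable_regMap B I hA₀.measurableSet
  have htr : ∀ (A : Set (EuclideanSpace ℝ (Fin M) × EuclideanSpace ℝ (Fin K)))
      (B' : Matrix (Fin M) (Fin K) ℝ), MeasurableSet A → (trimmedScatter α J A B').trace =
      α⁻¹ * ∫ p in regMap B I ⁻¹' A, ‖p.2 + rowMul (B - B') p.1‖ ^ 2 ∂(ν.prod κ) :=
    fun A B' hA => by rw [hJ]; exact trace_trimmedScatter hν2 hκ2 hA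
  have hzero : ∀ z, rowMul (B - B) z = 0 := fun z => by rw [rowMul_sub, sub_self]
  have hRm : ∀ B', Measurable fun p : EuclideanSpace ℝ (Fin M) × EuclideanSpace ℝ (Fin K) =>
      ‖p.2 + rowMul (B - B') p.1‖ ^ 2 := fun B' => by fun_prop
  have hRi : ∀ B', Integrable (fun p : EuclideanSpace ℝ (Fin M) × EuclideanSpace ℝ (Fin K) =>
      ‖p.2 + rowMul (B - B') p.1‖ ^ 2) (ν.prod κ) := fun B' =>
    (memLp_add_rowMul hν2 hκ2 (rowMul (B - B'))).integrable_norm_pow (by norm_num)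
  have h2 := fun c : EuclideanSpace ℝ (Fin K) => integral_sq_norm_add_of_centred hκ2 hκ0 c
  constructor
  · rintro ⟨A, hA, -, hmin⟩
    by_contra hne
    have hD : B - B' ≠ 0 := fun h => hne (sub_eq_zero.1 h).symm
    have hP := isTrimmingSet_preimage_eq hJ hA
    -- For almost every `z` the shift `z (B - B')` is nonzero, so `hκA` is strict and the untrimmed
    -- sum of squares grows by the squared norm of the shift.
    have hlt := trimmed_integral_lt (ν := ν) (κ := κ) (hRm B') (fun _ => by positivity) (hRi B')
      (R₀ := fun q => ‖q‖ ^ 2) (by fun_prop) (fun _ => by positivity)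
      (measurable_regMap B I hA.measurableSet) hm₀ (hP.trans hP₀.symm) hsub
      (by rw [hP]; simpa using hα0)
      (fun r hr => (ae_rowMul_ne hν hD 0).mono fun z hz => hκA _ hz r hr)
      ((ae_rowMul_ne hν hD 0).mono fun z hz => by
        simp only [h2]
        have := norm_pos_iff.2 hz
        nlinarith)
      ((ae_prod_ne_zero (T := I) hν hD).mono fun p hp => by
        have := norm_pos_iff.2 hp
        exact pow_pos this 2)
    have hle := hmin A₀ B hA₀ hfit
    rw [htr A B' hA.measurableSet, htr A₀ B hA₀.measurableSet] at hle
    simp only [hzero, add_zero] at hle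
    exact absurd (le_of_mul_le_mul_left hle (inv_pos.2 hα0)) (not_le.2 hlt)
  · rintro rfl
    refine ⟨A₀, hA₀, hfit, fun A B₁ hA _ => ?_⟩
    rw [htr A B₁ hA.measurableSet, htr A₀ B' hA₀.measurableSet]
    simp only [hzero, add_zero]
    refine mul_le_mul_of_nonneg_left ?_ (inv_pos.2 hα0).le
    refine trimmed_integral_le (hRm B₁) (fun _ => by positivity) (hRi B₁)
      (R₀ := fun q => ‖q‖ ^ 2) (by fun_prop) (fun _ => by positivity)
      (measurable_regMap B' I hA.measurableSet) hm₀
      ((isTrimmingSet_preimage_eq hJ hA).trans hP₀.symm) hsub (fun r hr z => ?_) (fun z => ?_)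
    · by_cases hz : rowMul (B' - B₁) z = 0
      · simp only [hz, add_zero]; exact le_rfl
      · exact (hκA _ hz r hr).le
    · simp only [h2]
      nlinarith [sq_nonneg ‖rowMul (B' - B₁) z‖]

end Trace

end RegressionCore

/-! ### The determinant criterion with nondegenerate Gaussian errors. -/

section Determinant

variable {M K : ℕ} {ν : Measure (EuclideanSpace ℝ (Fin M))} [IsProbabilityMeasure ν]
  {α : ℝ} {B B' : Matrix (Fin M) (Fin K) ℝ}
  {T : EuclideanSpace ℝ (Fin K) ≃L[ℝ] EuclideanSpace ℝ (Fin K)}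
  {J : Measure (EuclideanSpace ℝ (Fin M) × EuclideanSpace ℝ (Fin K))}

/-- Standardising the errors multiplies every determinant by the same positive factor when `α > 0`,
with `C = det T`, and hence keeps the minimisers. -/
lemma det_trimmedScatter_map_regMap {κ : Measure (EuclideanSpace ℝ (Fin K))}
    [IsProbabilityMeasure κ] (hν2 : MemLp id 2 ν) (hκ2 : MemLp id 2 κ)
    (T : EuclideanSpace ℝ (Fin K) ≃L[ℝ] EuclideanSpace ℝ (Fin K)) (α : ℝ) :
    ∃ C : ℝ, ∀ (B B' : Matrix (Fin M) (Fin K) ℝ)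
      (A : Set (EuclideanSpace ℝ (Fin M) × EuclideanSpace ℝ (Fin K))), MeasurableSet A →
      (trimmedScatter α ((ν.prod κ).map (regMap B T)) A B').det =
        (α⁻¹) ^ K * C ^ 2 * (momentMatrix ((ν.prod κ).restrict (regMap B T ⁻¹' A))
          (fun p => p.2 + T.symm (rowMul (B - B') p.1))).det ∧ C ≠ 0 := by
  set Tm := Matrix.toEuclideanLin.symm
    (T.toContinuousLinearMap : EuclideanSpace ℝ (Fin K) →ₗ[ℝ] EuclideanSpace ℝ (Fin K))
  have hTm : ∀ x, Matrix.toEuclideanLin Tm x = T x := fun x => by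
    simp [Tm]
  have hC : Tm.det ≠ 0 := by
    intro h0
    obtain ⟨v, hv, hv0⟩ := Matrix.exists_mulVec_eq_zero_iff.2 h0
    have h1 : T (WithLp.toLp 2 v) = 0 := by
      rw [← hTm, Matrix.toLpLin_apply]
      simp [hv0]
    have h2 := (map_eq_zero_iff T T.injective).1 h1
    exact hv (by simpa using h2)
  refine ⟨Tm.det, fun B B' A hA => ⟨?_, hC⟩⟩
  have hy : MemLp (fun p : EuclideanSpace ℝ (Fin M) × EuclideanSpace ℝ (Fin K) =>
      p.2 + T.symm (rowMul (B - B') p.1)) 2 ((ν.prod κ).restrict (regMap B T ⁻¹' A)) :=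
    (memLp_add_rowMul hν2 hκ2
      (T.symm.toContinuousLinearMap ∘L rowMul (B - B'))).mono_measure Measure.restrict_le_self
  rw [trimmedScatter_map_regMap hA]
  simp_rw [← hTm]
  rw [momentMatrix_toEuclideanLin hy, Matrix.det_smul, Matrix.det_mul, Matrix.det_mul,
    Matrix.det_transpose, Fintype.card_fin]
  ring

/-- For fixed `z`, a vanishing linear combination of the coordinates of `u + L z` confines `u` to an
affine hyperplane. Definiteness is what permits the normalisation by `exists_normalizing_matrix`. -/
lemma posDef_momentMatrix_gaussian_shift
    {A : Set (EuclideanSpace ℝ (Fin M) × EuclideanSpace ℝ (Fin K))}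
    (hν2 : MemLp id 2 ν) (hPA : ν.prod (stdGaussian (EuclideanSpace ℝ (Fin K))) A ≠ 0)
    (L : EuclideanSpace ℝ (Fin M) →L[ℝ] EuclideanSpace ℝ (Fin K)) :
    (momentMatrix ((ν.prod (stdGaussian (EuclideanSpace ℝ (Fin K)))).restrict A)
      (fun p => p.2 + L p.1)).PosDef := by
  have hy := (memLp_add_rowMul hν2 (κ := stdGaussian (EuclideanSpace ℝ (Fin K)))
    IsGaussian.memLp_two_id L).mono_measure (Measure.restrict_le_self (s := A))
  have : NeZero ((ν.prod (stdGaussian (EuclideanSpace ℝ (Fin K)))).restrict A) :=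
    ⟨by simpa [Measure.restrict_eq_zero] using hPA⟩
  refine posDef_momentMatrix hy fun v hv => ae_restrict_of_ae ?_
  have hmv : MeasurableSet {p : EuclideanSpace ℝ (Fin M) × EuclideanSpace ℝ (Fin K) |
      ∑ k, v k * (p.2 + L p.1) k ≠ 0} :=
    (measurableSet_eq_fun (by fun_prop) measurable_const).compl
  refine (Measure.ae_prod_iff_ae_ae hmv).2 (Filter.Eventually.of_forall fun z => ?_)
  have hv' : WithLp.toLp 2 v ≠ (0 : EuclideanSpace ℝ (Fin K)) := by simpa using hv
  filter_upwards [ae_inner_ne stdGaussian_absolutelyContinuous hv'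
    (-∑ k, v k * (L z) k)] with u hu h
  apply hu
  simp only [PiLp.add_apply, mul_add, Finset.sum_add_distrib] at h
  rw [PiLp.inner_apply]
  simp only [RCLike.inner_apply, conj_trivial]
  simp_rw [mul_comm _ (v _)]
  linarith

/-- Among all sets of a given mass, the determinant of the second moments of a shifted standard
Gaussian vector is smallest on centred balls. -/
lemma trimmed_moment_le_det
    {A A₀ : Set (EuclideanSpace ℝ (Fin M) × EuclideanSpace ℝ (Fin K))} (hK : 0 < K)
    (hν2 : MemLp id 2 ν) (hA : MeasurableSet A) (hA₀ : MeasurableSet A₀)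
    (hPA : ν.prod (stdGaussian (EuclideanSpace ℝ (Fin K))) A ≠ 0)
    (hAA : ν.prod (stdGaussian (EuclideanSpace ℝ (Fin K))) A =
      ν.prod (stdGaussian (EuclideanSpace ℝ (Fin K))) A₀)
    (hsub : IsSublevelLike (fun p => ‖p.2‖ ^ 2) A₀)
    (L : EuclideanSpace ℝ (Fin M) →L[ℝ] EuclideanSpace ℝ (Fin K)) :
    ((∫ p in A₀, ‖p.2‖ ^ 2 ∂(ν.prod (stdGaussian (EuclideanSpace ℝ (Fin K))))) / K) ^ K ≤
      (momentMatrix ((ν.prod (stdGaussian (EuclideanSpace ℝ (Fin K)))).restrict A)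
        (fun p => p.2 + L p.1)).det ∧
    ((∀ᵐ z ∂ν, L z ≠ 0) →
      (∀ᵐ p ∂(ν.prod (stdGaussian (EuclideanSpace ℝ (Fin K)))), p.2 + L p.1 ≠ 0) →
      ((∫ p in A₀, ‖p.2‖ ^ 2 ∂(ν.prod (stdGaussian (EuclideanSpace ℝ (Fin K))))) / K) ^ K <
      (momentMatrix ((ν.prod (stdGaussian (EuclideanSpace ℝ (Fin K)))).restrict A)
        (fun p => p.2 + L p.1)).det) := by
  have hK' : (0 : ℝ) < K := by exact_mod_cast hK
  have hyg := memLp_add_rowMul hν2 (κ := stdGaussian (EuclideanSpace ℝ (Fin K)))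
    IsGaussian.memLp_two_id L
  have hy := hyg.mono_measure (Measure.restrict_le_self (s := A))
  have hN := posDef_momentMatrix_gaussian_shift hν2 hPA L
  -- After normalisation the determinant is `(s ^ 2) ^ K`, where `K * s ^ 2` is the trimmed integral
  -- of `‖W (u + L z)‖ ^ 2`; the trace comparison for volume preserving maps applies to it.
  obtain ⟨W, s, hWdet, hWN, hdet⟩ := exists_normalizing_matrix hN hK
  have hWl : |LinearMap.det (Matrix.toEuclideanLin W)| = 1 := by
    rw [LinearMap.det_toLpLin, hWdet, abs_one]
  have hs := congrArg Matrix.trace (momentMatrix_toEuclideanLin hy W)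
  rw [hWN, Matrix.trace_smul, Matrix.trace_one, Fintype.card_fin, smul_eq_mul] at hs
  generalize Matrix.toEuclideanLin W = Wl at hWl hs
  have hWc : Continuous Wl := Wl.continuous_of_finiteDimensional
  have hWy : MemLp (fun p : EuclideanSpace ℝ (Fin M) × EuclideanSpace ℝ (Fin K) =>
      Wl (p.2 + L p.1)) 2 (ν.prod (stdGaussian (EuclideanSpace ℝ (Fin K)))) :=
    (LinearMap.toContinuousLinearMap Wl).comp_memLp' hyg
  rw [trace_momentMatrix (hWy.mono_measure Measure.restrict_le_self)] at hs
  have hRm : Measurable fun p : EuclideanSpace ℝ (Fin M) × EuclideanSpace ℝ (Fin K) =>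
    ‖Wl (p.2 + L p.1)‖ ^ 2 := by fun_prop
  have hRi : Integrable (fun p : EuclideanSpace ℝ (Fin M) × EuclideanSpace ℝ (Fin K) =>
      ‖Wl (p.2 + L p.1)‖ ^ 2) (ν.prod (stdGaussian (EuclideanSpace ℝ (Fin K)))) :=
    hWy.integrable_norm_pow (by norm_num)
  have hlam : 0 ≤ (∫ p in A₀, ‖p.2‖ ^ 2
      ∂(ν.prod (stdGaussian (EuclideanSpace ℝ (Fin K))))) / K :=
    div_nonneg (integral_nonneg fun _ => by positivity) hK'.le
  rw [hdet]
  constructor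
  · refine pow_le_pow_left₀ hlam ?_ K
    rw [div_le_iff₀ hK', ← hs]
    exact trimmed_integral_le hRm (fun _ => by positivity) hRi
      (R₀ := fun q => ‖q‖ ^ 2) (by fun_prop) (fun _ => by positivity) hA hA₀ hAA hsub
      (fun r _ z => integral_max_sub_sq_le_stdGaussian hWl (L z) r)
      (fun z => integral_sq_norm_le_stdGaussian hWl (L z))
  · intro hae hne
    refine pow_lt_pow_left₀ ?_ hlam hK.ne'
    rw [div_lt_iff₀ hK', ← hs]
    exact trimmed_integral_lt hRm (fun _ => by positivity) hRi
      (R₀ := fun q => ‖q‖ ^ 2) (by fun_prop) (fun _ => by positivity) hA hA₀ hAA hsub hPA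
      (fun r hr => hae.mono fun z hz => integral_max_sub_sq_lt_stdGaussian hWl (c := L z) hz hr)
      (hae.mono fun z hz => integral_sq_norm_lt_stdGaussian hWl (c := L z) hz)
      (hne.mono fun p hp => pow_pos (norm_pos_iff.2 (linear_apply_ne_zero hWl hp)) 2)

/-- The determinant form of least trimmed squares recovers the coefficient matrix of a linear model
with a predictor that is symmetric and has a density, and a nondegenerate Gaussian error. -/
theorem isMLTS_det_iff (hM : 0 < M) (hK : 0 < K) (hν : ν ≪ volume)
    (hsym : ν.map (fun z => -z) = ν) (hν2 : MemLp id 2 ν) (hα0 : 0 < α) (hα1 : α ≤ 1)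
    (T : EuclideanSpace ℝ (Fin K) ≃L[ℝ] EuclideanSpace ℝ (Fin K))
    (hJ : J = (ν.prod (stdGaussian (EuclideanSpace ℝ (Fin K)))).map (regMap B T)) :
    IsMLTS Matrix.det α J B' ↔ B' = B := by
  set κ := stdGaussian (EuclideanSpace ℝ (Fin K))
  have hκ2 : MemLp id 2 κ := IsGaussian.memLp_two_id
  have hK' : (0 : ℝ) < K := by exact_mod_cast hK
  obtain ⟨A₀, hA₀, hfit, hsub⟩ := exists_isTrimmingSet hM hν hsym hν2 hκ2 hα0 hα1 B T
  rw [← hJ] at hA₀ hfit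
  have hP₀ := isTrimmingSet_preimage_eq hJ hA₀
  have hm₀ : MeasurableSet (regMap B T ⁻¹' A₀) := measurable_regMap B T hA₀.measurableSet
  obtain ⟨C, hC⟩ := det_trimmedScatter_map_regMap hν2 hκ2 T α
  have hC0 : C ≠ 0 := (hC B B' A₀ hA₀.measurableSet).2
  have hpos : 0 < (α⁻¹) ^ K * C ^ 2 := by positivity
  have hzero : ∀ z, rowMul (B - B) z = 0 := fun z => by rw [rowMul_sub, sub_self]
  have hyg : ∀ B', MemLp (fun p : EuclideanSpace ℝ (Fin M) × EuclideanSpace ℝ (Fin K) =>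
      p.2 + T.symm (rowMul (B - B') p.1)) 2 (ν.prod κ) := fun B' =>
    memLp_add_rowMul hν2 hκ2 (T.symm.toContinuousLinearMap ∘L rowMul (B - B'))
  set lam := (∫ p in regMap B T ⁻¹' A₀, ‖p.2‖ ^ 2 ∂(ν.prod κ)) / K
  have hlam : 0 ≤ lam := div_nonneg (integral_nonneg fun _ => by positivity) hK'.le
  -- An upper bound by the arithmetic-geometric inequality is enough: it matches the lower bound
  -- `hmain`, so the scatter on `A₀` need not be computed.
  have hopt : (trimmedScatter α J A₀ B).det ≤ (α⁻¹) ^ K * C ^ 2 * lam ^ K := by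
    rw [hJ, (hC B B A₀ hA₀.measurableSet).1]
    refine mul_le_mul_of_nonneg_left ?_ hpos.le
    have hy := (hyg B).mono_measure
      (Measure.restrict_le_self (μ := ν.prod κ) (s := regMap B T ⁻¹' A₀))
    refine (det_le_trace_div_pow (posSemidef_momentMatrix hy) hK).trans_eq ?_
    rw [trace_momentMatrix hy]
    simp only [hzero, map_zero, add_zero, lam]
  have hmain : ∀ (A : Set (EuclideanSpace ℝ (Fin M) × EuclideanSpace ℝ (Fin K)))
      (B₁ : Matrix (Fin M) (Fin K) ℝ), IsTrimmingSet α J A →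
      (α⁻¹) ^ K * C ^ 2 * lam ^ K ≤ (trimmedScatter α J A B₁).det ∧
      (B₁ ≠ B → (α⁻¹) ^ K * C ^ 2 * lam ^ K < (trimmedScatter α J A B₁).det) := by
    intro A B₁ hA
    have hP := isTrimmingSet_preimage_eq hJ hA
    have hm : MeasurableSet (regMap B T ⁻¹' A) := measurable_regMap B T hA.measurableSet
    have hPA : ν.prod κ (regMap B T ⁻¹' A) ≠ 0 := by rw [hP]; simpa using hα0
    rw [hJ, (hC B B₁ A hA.measurableSet).1]
    have hcmp := trimmed_moment_le_det hK hν2 hm hm₀ hPA (hP.trans hP₀.symm) hsub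
      (T.symm.toContinuousLinearMap ∘L rowMul (B - B₁))
    refine ⟨mul_le_mul_of_nonneg_left hcmp.1 hpos.le, fun hne =>
      mul_lt_mul_of_pos_left (hcmp.2 ?_ ?_) hpos⟩
    · exact (ae_rowMul_ne hν (fun h => hne (sub_eq_zero.1 h).symm) 0).mono fun z hz h =>
        hz ((map_eq_zero_iff T.symm T.symm.injective).1 h)
    · exact ae_prod_ne_zero hν (fun h => hne (sub_eq_zero.1 h).symm)
  constructor
  · rintro ⟨A, hA, -, hmin⟩
    by_contra hne
    exact absurd ((hmin A₀ B hA₀ hfit).trans hopt) (not_le.2 ((hmain A B' hA).2 hne))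
  · rintro rfl
    exact ⟨A₀, hA₀, hfit, fun A B₁ hA _ => hopt.trans (hmain A B₁ hA).1⟩

end Determinant

/-! ### Linear marginals of spherical laws. -/

section SphericalLaws

variable {n : ℕ}

/-- A law on Euclidean space with a density that is a function of the norm is invariant under
linear isometries. -/
lemma map_linearIsometryEquiv_withDensity_norm (h : ℝ → ℝ≥0)
    (e : EuclideanSpace ℝ (Fin n) ≃ₗᵢ[ℝ] EuclideanSpace ℝ (Fin n)) :
    (volume.withDensity fun x : EuclideanSpace ℝ (Fin n) => (h ‖x‖ : ℝ≥0∞)).map e =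
      volume.withDensity fun x : EuclideanSpace ℝ (Fin n) => (h ‖x‖ : ℝ≥0∞) := by
  ext s hs
  have hmp := e.measurePreserving
  have h1 := hmp.setLIntegral_comp_preimage_emb e.toHomeomorph.measurableEmbedding
    (fun x => (h ‖x‖ : ℝ≥0∞)) s
  rw [Measure.map_apply e.continuous.measurable hs, withDensity_apply _ hs,
    withDensity_apply _ (e.continuous.measurable hs)]
  simpa using h1

/-- The reflection in the hyperplane orthogonal to `x - y` carries `x` to `y` and preserves `ν`. -/
lemma map_inner_eq_of_norm_eq {ν : Measure (EuclideanSpace ℝ (Fin n))}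
    (hinv : ∀ e : EuclideanSpace ℝ (Fin n) ≃ₗᵢ[ℝ] EuclideanSpace ℝ (Fin n), ν.map e = ν)
    {x y : EuclideanSpace ℝ (Fin n)} (hxy : ‖x‖ = ‖y‖) :
    ν.map (fun z => ⟪x, z⟫) = ν.map (fun z => ⟪y, z⟫) := by
  set e := (ℝ ∙ (x - y))ᗮ.reflection
  have he : e x = y := Submodule.reflection_sub hxy
  conv_rhs => rw [← hinv e]
  rw [Measure.map_map (by fun_prop) e.continuous.measurable]
  congr 1
  ext z
  rw [Function.comp_apply, ← he, e.inner_map_map]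

lemma map_inner_eq_map_mul {ν : Measure (EuclideanSpace ℝ (Fin n))}
    (hinv : ∀ e : EuclideanSpace ℝ (Fin n) ≃ₗᵢ[ℝ] EuclideanSpace ℝ (Fin n), ν.map e = ν)
    {x₀ : EuclideanSpace ℝ (Fin n)} (hx₀ : ‖x₀‖ = 1) (x : EuclideanSpace ℝ (Fin n)) :
    ν.map (fun z => ⟪x, z⟫) = (ν.map fun z => ⟪x₀, z⟫).map (fun t => ‖x‖ * t + 0) := by
  rw [map_inner_eq_of_norm_eq hinv (y := ‖x‖ • x₀) (by simp [norm_smul, hx₀]),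
    Measure.map_map (by fun_prop) (by fun_prop)]
  congr 1
  ext z
  simp [real_inner_smul_left]

end SphericalLaws

/-! ### Scores and linear combinations of an orthonormal system. -/

section Span

variable {H : Type*} [NormedAddCommGroup H] [InnerProductSpace ℝ H] {n : ℕ} {φ : Fin n → H}

/-- The linear combination `∑ₖ xₖ φₖ`. -/
noncomputable def lincomb (φ : Fin n → H) (x : EuclideanSpace ℝ (Fin n)) : H :=
  ∑ k, x k • φ k

lemma scores_apply (φ : Fin n → H) (f : H) (k : Fin n) : scores φ f k = ⟪φ k, f⟫ := rfl

lemma continuous_scores (φ : Fin n → H) : Continuous (scores φ) :=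
  (PiLp.continuous_toLp 2 _).comp
    (continuous_pi fun _ => continuous_const.inner continuous_id)

lemma scores_sub (φ : Fin n → H) (f g : H) : scores φ (f - g) = scores φ f - scores φ g := by
  ext k; simp [scores_apply, inner_sub_right]

lemma scores_add (φ : Fin n → H) (f g : H) : scores φ (f + g) = scores φ f + scores φ g := by
  ext k; simp [scores_apply, inner_add_right]

lemma inner_lincomb_right (φ : Fin n → H) (x : EuclideanSpace ℝ (Fin n)) (g : H) :
    ⟪g, lincomb φ x⟫ = ⟪scores φ g, x⟫ := by
  rw [lincomb, inner_sum, PiLp.inner_apply]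
  refine Finset.sum_congr rfl fun k _ => ?_
  rw [real_inner_smul_right, scores_apply, real_inner_comm]
  simp

lemma inner_lincomb_left (φ : Fin n → H) (x : EuclideanSpace ℝ (Fin n)) (g : H) :
    ⟪lincomb φ x, g⟫ = ⟪x, scores φ g⟫ := by
  rw [real_inner_comm, inner_lincomb_right, real_inner_comm]

lemma lincomb_single [DecidableEq (Fin n)] (φ : Fin n → H) (m : Fin n) :
    lincomb φ (EuclideanSpace.single m 1) = φ m := by
  simp [lincomb]

lemma Orthonormal.scores_lincomb (hφ : Orthonormal ℝ φ) (x : EuclideanSpace ℝ (Fin n)) :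
    scores φ (lincomb φ x) = x := by
  ext k
  rw [scores_apply, lincomb, hφ.inner_right_fintype]

lemma Orthonormal.norm_lincomb (hφ : Orthonormal ℝ φ) (x : EuclideanSpace ℝ (Fin n)) :
    ‖lincomb φ x‖ = ‖x‖ := by
  have : ‖lincomb φ x‖ ^ 2 = ‖x‖ ^ 2 := by
    rw [← real_inner_self_eq_norm_sq, inner_lincomb_right, hφ.scores_lincomb,
      real_inner_self_eq_norm_sq]
  exact (pow_left_inj₀ (norm_nonneg _) (norm_nonneg _) two_ne_zero).1 this

lemma Orthonormal.norm_sq_eq_scores_add (hφ : Orthonormal ℝ φ) (g : H) :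
    ‖g‖ ^ 2 = ‖scores φ g‖ ^ 2 + ‖g - lincomb φ (scores φ g)‖ ^ 2 := by
  rw [norm_sub_sq_real, inner_lincomb_right, real_inner_self_eq_norm_sq, hφ.norm_lincomb]
  ring

lemma Orthonormal.norm_scores_le (hφ : Orthonormal ℝ φ) (g : H) : ‖scores φ g‖ ≤ ‖g‖ := by
  rw [← sq_le_sq₀ (norm_nonneg _) (norm_nonneg _), hφ.norm_sq_eq_scores_add g]
  linarith [sq_nonneg ‖g - lincomb φ (scores φ g)‖]

/-- Equality in Bessel's inequality forces `g` into the span. -/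
lemma Orthonormal.eq_lincomb_of_norm_le (hφ : Orthonormal ℝ φ) {g : H}
    (h : ‖g‖ ≤ ‖scores φ g‖) : g = lincomb φ (scores φ g) := by
  have h1 := hφ.norm_sq_eq_scores_add g
  have h2 : ‖g‖ ^ 2 ≤ ‖scores φ g‖ ^ 2 := pow_le_pow_left₀ (norm_nonneg _) h 2
  have h3 : ‖g - lincomb φ (scores φ g)‖ ^ 2 = 0 := le_antisymm (by linarith) (sq_nonneg _)
  exact sub_eq_zero.1 (norm_eq_zero.1 (pow_eq_zero_iff two_ne_zero |>.1 h3))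

/-- An orthonormal system in the span of an orthonormal system of the same size spans it. -/
lemma Orthonormal.lincomb_eq_of_forall_eq_lincomb (hφ : Orthonormal ℝ φ) {ψ : Fin n → H}
    (hψ : Orthonormal ℝ ψ) (h : ∀ j, ψ j = lincomb φ (scores φ (ψ j))) (m : Fin n) :
    φ m = lincomb ψ (scores ψ (φ m)) := by
  set o : Fin n → EuclideanSpace ℝ (Fin n) := fun j => scores φ (ψ j)
  have ho : Orthonormal ℝ o := by
    rw [orthonormal_iff_ite] at hψ ⊢
    intro i j
    rw [← hψ i j]
    conv_rhs => rw [h j]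
    rw [inner_lincomb_right]
  refine hψ.eq_lincomb_of_norm_le ?_
  -- The scores of the `ψ j` form an orthonormal basis of `ℝⁿ`. Parseval's identity for a coordinate
  -- vector then gives equality in Bessel's inequality for `φ m`.
  set b := OrthonormalBasis.mk ho
    (ho.linearIndependent.span_eq_top_of_card_eq_finrank' (by simp)).ge
  have hb : ∀ k, b k = o k := fun k => by simp [b]
  have h1 : ∀ k, scores ψ (φ m) k = ⟪b k, EuclideanSpace.single m (1 : ℝ)⟫ := fun k => by
    rw [hb, scores_apply, EuclideanSpace.inner_single_right, real_inner_comm]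
    simp [o, scores_apply]
  rw [← sq_le_sq₀ (norm_nonneg _) (norm_nonneg _), EuclideanSpace.real_norm_sq_eq]
  simp_rw [h1]
  rw [b.sum_sq_inner_right, hφ.1 m]
  simp

end Span

/-! ### Projection-pursuit components under spherical scores. -/

section PrincipalComponents

variable {H : Type*} [NormedAddCommGroup H] [InnerProductSpace ℝ H]
  [MeasurableSpace H] [BorelSpace H] {P : Measure H} [IsProbabilityMeasure P] {n : ℕ}
  {φ ψ : Fin n → H} {sc : Measure ℝ → ℝ}

omit [BorelSpace H] [IsProbabilityMeasure P] in
lemma memLp_scores (hP2 : MemLp id 2 P) (φ : Fin n → H) : MemLp (scores φ) 2 P := by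
  refine MemLp.of_eval_piLp fun k => ?_
  exact (innerSL ℝ (φ k)).comp_memLp' hP2

omit [BorelSpace H] [IsProbabilityMeasure P] in
lemma memLp_inner (hP2 : MemLp id 2 P) (g : H) : MemLp (fun f => ⟪g, f⟫) 2 P :=
  (innerSL ℝ g).comp_memLp' hP2

lemma isProbabilityMeasure_map_scores (φ : Fin n → H) :
    IsProbabilityMeasure (P.map (scores φ)) :=
  Measure.isProbabilityMeasure_map (continuous_scores φ).measurable.aemeasurable

omit [IsProbabilityMeasure P] in
lemma memLp_id_map_scores (hP2 : MemLp id 2 P) (φ : Fin n → H) :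
    MemLp id 2 (P.map (scores φ)) :=
  (memLp_map_measure_iff aestronglyMeasurable_id
    (continuous_scores φ).measurable.aemeasurable).2 (memLp_scores hP2 φ)

omit [BorelSpace H] [IsProbabilityMeasure P] in
lemma HasSphericalScores.map_eq (h : HasSphericalScores P φ)
    (e : EuclideanSpace ℝ (Fin n) ≃ₗᵢ[ℝ] EuclideanSpace ℝ (Fin n)) :
    (P.map (scores φ)).map e = P.map (scores φ) := by
  obtain ⟨d, -, hd⟩ := h
  rw [hd]
  exact map_linearIsometryEquiv_withDensity_norm d e

omit [BorelSpace H] [IsProbabilityMeasure P] in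
lemma HasSphericalScores.absolutelyContinuous (h : HasSphericalScores P φ) :
    P.map (scores φ) ≪ volume := by
  obtain ⟨d, -, hd⟩ := h
  rw [hd]
  exact withDensity_absolutelyContinuous _ _

omit [IsProbabilityMeasure P] in
lemma map_inner_lincomb (x : EuclideanSpace ℝ (Fin n)) :
    P.map (fun f => ⟪lincomb φ x, f⟫) = (P.map (scores φ)).map (fun z => ⟪x, z⟫) := by
  rw [Measure.map_map (by fun_prop) (continuous_scores φ).measurable]
  simp_rw [inner_lincomb_left]
  rfl

omit [BorelSpace H] [IsProbabilityMeasure P] in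
lemma inner_ae_eq_lincomb (hspan : ∀ᵐ f ∂P, f = lincomb φ (scores φ f)) (g : H) :
    (fun f => ⟪g, f⟫) =ᵐ[P] fun f => ⟪lincomb φ (scores φ g), f⟫ := by
  filter_upwards [hspan] with f hf
  rw [inner_lincomb_left]
  conv_lhs => rw [hf, inner_lincomb_right]

omit [IsProbabilityMeasure P] in
/-- The marginal law of spherical scores along a coordinate direction. -/
lemma map_inner_lincomb_eq (hsph : HasSphericalScores P φ) (j : Fin n)
    (x : EuclideanSpace ℝ (Fin n)) :
    P.map (fun f => ⟪lincomb φ x, f⟫) =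
      (P.map fun f => ⟪φ j, f⟫).map (fun t => ‖x‖ * t + 0) := by
  rw [map_inner_lincomb, map_inner_eq_map_mul hsph.map_eq
    (x₀ := EuclideanSpace.single j 1) (by simp), ← map_inner_lincomb, lincomb_single]

omit [IsProbabilityMeasure P] in
lemma memLp_id_map_inner (hP2 : MemLp id 2 P) (g : H) :
    MemLp (fun x : ℝ => x) 2 (P.map fun f => ⟪g, f⟫) :=
  (memLp_map_measure_iff aestronglyMeasurable_id
    (by fun_prop : Measurable fun f : H => ⟪g, f⟫).aemeasurable).2 (memLp_inner hP2 g)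

lemma isProbabilityMeasure_map_inner (g : H) :
    IsProbabilityMeasure (P.map fun f => ⟪g, f⟫) :=
  Measure.isProbabilityMeasure_map (by fun_prop : Measurable fun f : H => ⟪g, f⟫).aemeasurable

lemma scale_smul (hsc : IsScaleFunctional sc) (hP2 : MemLp id 2 P) (c : ℝ) (g : H) :
    sc (P.map fun f => ⟪c • g, f⟫) = |c| * sc (P.map fun f => ⟪g, f⟫) := by
  rw [← hsc.map_affine _ (isProbabilityMeasure_map_inner g) (memLp_id_map_inner hP2 g) c 0,
    Measure.map_map (by fun_prop) (by fun_prop)]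
  congr 2
  ext f
  simp [real_inner_smul_left]

/-- On the span the scale is a fixed multiple of the norm, so there it prefers no direction. -/
lemma scale_lincomb (hsc : IsScaleFunctional sc) (hP2 : MemLp id 2 P)
    (hsph : HasSphericalScores P φ) (j : Fin n) (x : EuclideanSpace ℝ (Fin n)) :
    sc (P.map fun f => ⟪lincomb φ x, f⟫) = ‖x‖ * sc (P.map fun f => ⟪φ j, f⟫) := by
  rw [map_inner_lincomb_eq hsph j, hsc.map_affine _ (isProbabilityMeasure_map_inner _)
    (memLp_id_map_inner hP2 _), abs_norm]

lemma scale_pos (hsc : IsScaleFunctional sc) (hP2 : MemLp id 2 P)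
    (hsph : HasSphericalScores P φ) (j : Fin n) : 0 < sc (P.map fun f => ⟪φ j, f⟫) := by
  classical
  refine hsc.pos _ (isProbabilityMeasure_map_inner _) (memLp_id_map_inner hP2 _) ?_
  rw [← lincomb_single φ j, map_inner_lincomb]
  exact map_inner_absolutelyContinuous hsph.absolutelyContinuous (by simp)

lemma exists_ne_zero_forall_inner_eq_zero (o : Fin n → EuclideanSpace ℝ (Fin n)) (j : Fin n) :
    ∃ x : EuclideanSpace ℝ (Fin n), x ≠ 0 ∧ ∀ i < j, ⟪o i, x⟫ = 0 := by
  let F : EuclideanSpace ℝ (Fin n) →ₗ[ℝ] (Fin j → ℝ) :=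
    LinearMap.pi fun i => innerₛₗ ℝ (o ⟨i, i.2.trans j.2⟩)
  have hF : LinearMap.ker F ≠ ⊥ := F.ker_ne_bot_of_finrank_lt (by simp)
  obtain ⟨x, hx, hx0⟩ := Submodule.exists_mem_ne_zero_of_ne_bot hF
  refine ⟨x, hx0, fun i hi => ?_⟩
  have := congrFun (LinearMap.mem_ker.1 hx) ⟨i, hi⟩
  simpa [F] using this

/-- If a law is concentrated on the span of `φ₁, …, φₙ` with spherical scores, then all its
projection-pursuit principal components lie in that span. -/
lemma IsRobustFPC.eq_lincomb (hsc : IsScaleFunctional sc) (hP2 : MemLp id 2 P)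
    (hφ : Orthonormal ℝ φ) (hsph : HasSphericalScores P φ)
    (hspan : ∀ᵐ f ∂P, f = lincomb φ (scores φ f)) (hψ : IsRobustFPC sc P ψ) (j : Fin n) :
    ψ j = lincomb φ (scores φ (ψ j)) := by
  have hpos := scale_pos hsc hP2 hsph j
  refine hφ.eq_lincomb_of_norm_le ?_
  -- Fewer than `n` earlier components leave an admissible unit vector in the span, of the full
  -- scale. Against it, `ψ j` can be maximal only if its projection to the span has norm at least
  -- one.
  obtain ⟨x, hx0, hx⟩ := exists_ne_zero_forall_inner_eq_zero (fun i => scores φ (ψ i)) j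
  have hxn : ‖x‖ ≠ 0 := norm_ne_zero_iff.2 hx0
  have hu : ‖‖x‖⁻¹ • x‖ = 1 := by
    rw [norm_smul, norm_inv, norm_norm, inv_mul_cancel₀ hxn]
  have h := hψ.maximal j (lincomb φ (‖x‖⁻¹ • x)) (by rw [hφ.norm_lincomb, hu]) fun i hi => by
    rw [inner_lincomb_right, real_inner_smul_right, hx i hi, mul_zero]
  rw [scale_lincomb hsc hP2 hsph j, hu, Measure.map_congr (inner_ae_eq_lincomb hspan (ψ j)),
    scale_lincomb hsc hP2 hsph j] at h
  rw [hψ.orthonormal.1 j]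
  exact le_of_mul_le_mul_right h hpos

omit [IsProbabilityMeasure P] in
lemma variance_inner_eq (hsph : HasSphericalScores P φ)
    (hspan : ∀ᵐ f ∂P, f = lincomb φ (scores φ f)) (j : Fin n) (g : H) :
    Var[fun f => ⟪g, f⟫; P] = ‖scores φ g‖ ^ 2 * Var[fun f => ⟪φ j, f⟫; P] := by
  have hm : ∀ g : H, AEMeasurable (fun f : H => ⟪g, f⟫) P := fun g =>
    (by fun_prop : Measurable fun f : H => ⟪g, f⟫).aemeasurable
  rw [variance_congr (inner_ae_eq_lincomb hspan g), ← variance_id_map (hm _),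
    map_inner_lincomb_eq hsph j, variance_map aemeasurable_id (by fun_prop)]
  simp only [add_zero, CompTriple.comp_eq]
  rw [variance_const_mul]
  congr 1
  exact variance_id_map (hm _)

/-- If a law is concentrated on the span of `φ₁, …, φₙ` with spherical scores, then all its
projection-pursuit principal components are functional principal components. -/
lemma IsRobustFPC.exists_isFPC (hsc : IsScaleFunctional sc) (hP2 : MemLp id 2 P)
    (hφ : Orthonormal ℝ φ) (hsph : HasSphericalScores P φ)
    (hspan : ∀ᵐ f ∂P, f = lincomb φ (scores φ f)) (hψ : IsRobustFPC sc P ψ) :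
    ∃ ev, IsFPC P ψ ev := by
  rcases Nat.eq_zero_or_pos n with rfl | hn
  · exact ⟨fun _ => 0, hψ.orthonormal, fun j => j.elim0, fun j => j.elim0, fun j => j.elim0⟩
  set c := Var[fun f => ⟪φ ⟨0, hn⟩, f⟫; P]
  have hvar : ∀ g, Var[fun f => ⟪g, f⟫; P] = ‖scores φ g‖ ^ 2 * c :=
    variance_inner_eq hsph hspan ⟨0, hn⟩
  have hc : 0 ≤ c := variance_nonneg _ _
  refine ⟨fun _ => c, hψ.orthonormal, fun j g => ?_, antitone_const, fun j g hg _ => ?_⟩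
  -- Polarisation: the variance is `c` times a squared norm of scores, hence the covariance is `c`
  -- times their inner product.
  · have h1 := variance_fun_add (memLp_inner hP2 (ψ j)) (memLp_inner hP2 g)
    simp_rw [← inner_add_left] at h1
    rw [hvar, hvar, hvar, scores_add, norm_add_sq_real] at h1
    have h2 : ⟪ψ j, g⟫ = ⟪scores φ (ψ j), scores φ g⟫ := by
      conv_lhs => rw [hψ.eq_lincomb hsc hP2 hφ hsph hspan j, inner_lincomb_left]
    rw [h2]
    linarith
  · rw [hvar]
    have := hφ.norm_scores_le g
    rw [hg] at this
    nlinarith [norm_nonneg (scores φ g), pow_le_one₀ (n := 2) (norm_nonneg (scores φ g)) this]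

omit [BorelSpace H] [IsProbabilityMeasure P] in
-- The exceptional null set depends on `g`, so a countable dense family of directions is used and
-- the conclusion extended by continuity.
lemma eq_lincomb_of_forall_inner_ae_eq_zero [SecondCountableTopology H]
    (h : ∀ g : H, (∀ k, ⟪φ k, g⟫ = 0) → ∀ᵐ f ∂P, ⟪g, f⟫ = 0) (hφ : Orthonormal ℝ φ) :
    ∀ᵐ f ∂P, f = lincomb φ (scores φ f) := by
  have h1 : ∀ i, ∀ᵐ f ∂P, ⟪TopologicalSpace.denseSeq H i -
      lincomb φ (scores φ (TopologicalSpace.denseSeq H i)), f⟫ = 0 := fun i => h _ fun k => by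
    change scores φ (TopologicalSpace.denseSeq H i -
      lincomb φ (scores φ (TopologicalSpace.denseSeq H i))) k = 0
    rw [scores_sub, hφ.scores_lincomb, sub_self]
    rfl
  filter_upwards [ae_all_iff.2 h1] with f hf
  have h2 : ∀ d, ⟪d, f - lincomb φ (scores φ f)⟫ = 0 := fun d => by
    have hcl : IsClosed {d : H | ⟪d, f - lincomb φ (scores φ f)⟫ = 0} :=
      isClosed_eq (by fun_prop) continuous_const
    refine (TopologicalSpace.denseRange_denseSeq H).induction_on
      (p := fun d => ⟪d, f - lincomb φ (scores φ f)⟫ = 0) d hcl fun i => ?_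
    rw [inner_sub_right, inner_lincomb_right, ← inner_lincomb_left, ← inner_sub_left, hf i]
  exact sub_eq_zero.1 (inner_self_eq_zero.1 (h2 _))

/-- A centred law with at most `n` nonzero principal components is concentrated on the span of
any `n` projection-pursuit principal components with spherical scores. -/
lemma IsRobustFPC.ae_eq_lincomb [CompleteSpace H] [SecondCountableTopology H]
    (hsc : IsScaleFunctional sc)
    (hP2 : MemLp id 2 P) (hP0 : ∫ f, f ∂P = 0) (hn : 0 < n) (hKL : HasFiniteKL P n)
    (hφ : IsRobustFPC sc P φ) (hsph : HasSphericalScores P φ) :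
    ∀ᵐ f ∂P, f = lincomb φ (scores φ f) := by
  obtain ⟨e, ev, -, hvar⟩ := hKL
  have hker : ∀ g : H, (∀ i, ⟪e i, g⟫ = 0) → ∀ᵐ f ∂P, ⟪g, f⟫ = 0 := by
    intro g hg
    have h1 := ae_eq_integral_of_variance_eq_zero (memLp_inner hP2 g) (hvar g hg)
    have h2 : ∫ f, ⟪g, f⟫ ∂P = 0 := by
      have := integral_inner (𝕜 := ℝ) (hP2.integrable (by norm_num)) g
      simpa [hP0] using this
    rw [h2] at h1
    exact h1
  let F : EuclideanSpace ℝ (Fin n) →ₗ[ℝ] (Fin n → ℝ) :=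
    LinearMap.pi fun i => innerₛₗ ℝ (scores φ (e i))
  have hF : ∀ x i, F x i = ⟪e i, lincomb φ x⟫ := fun x i => by
    rw [inner_lincomb_right]; rfl
  -- A kernel vector would make a nontrivial combination of the scores vanish almost surely, against
  -- their density.
  have hinj : Function.Injective F := by
    refine (injective_iff_map_eq_zero F).2 fun x hx => ?_
    by_contra hx0
    have h1 := hker (lincomb φ x) fun i => by rw [← hF, hx]; rfl
    have h2 := ae_inner_ne hsph.absolutelyContinuous hx0 0
    have h3 := ae_of_ae_map (continuous_scores φ).measurable.aemeasurable h2
    obtain ⟨f, hf1, hf2⟩ := (h1.and h3).exists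
    exact hf2 (by rw [← inner_lincomb_left, hf1])
  have hsurj : Function.Surjective F :=
    (LinearMap.injective_iff_surjective_of_finrank_eq_finrank (by simp)).1 hinj
  have hpos := scale_pos hsc hP2 hsph ⟨0, hn⟩
  set σ := sc (P.map fun f => ⟪φ ⟨0, hn⟩, f⟫)
  -- The first component competes with all unit vectors, so homogeneity gives a bound for every
  -- direction.
  have hmax : ∀ g : H, sc (P.map fun f => ⟪g, f⟫) ≤ ‖g‖ * σ := by
    intro g
    by_cases hg : g = 0
    · have := scale_smul hsc hP2 0 g
      rw [zero_smul] at this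
      rw [hg, this]
      simp
    · have hgn : ‖g‖ ≠ 0 := norm_ne_zero_iff.2 hg
      have h1 : g = ‖g‖ • (‖g‖⁻¹ • g) := by rw [smul_smul, mul_inv_cancel₀ hgn, one_smul]
      have h2 := hφ.maximal ⟨0, hn⟩ (‖g‖⁻¹ • g)
        (by rw [norm_smul, norm_inv, norm_norm, inv_mul_cancel₀ hgn])
        fun i hi => absurd hi (by simp [Fin.lt_def])
      conv_lhs => rw [h1]
      rw [scale_smul hsc hP2, abs_norm]
      exact mul_le_mul_of_nonneg_left h2 (norm_nonneg _)
  refine eq_lincomb_of_forall_inner_ae_eq_zero (fun g hg => ?_) hφ.orthonormal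
  -- Some vector of the span has the same products with all `e i` as `g`, hence almost surely the
  -- same projection as `g`, although it is orthogonal to `g`.
  obtain ⟨x, hx⟩ := hsurj fun i => ⟪e i, g⟫
  have hgx : (fun f => ⟪g, f⟫) =ᵐ[P] fun f => ⟪lincomb φ x, f⟫ := by
    filter_upwards [hker (g - lincomb φ x) fun i => by
      rw [inner_sub_right, ← hF, hx, sub_self]] with f hf
    rwa [inner_sub_left, sub_eq_zero] at hf
  have hx0 : x = 0 := by
    by_contra hx0
    have hxn : 0 < ‖x‖ := norm_pos_iff.2 hx0
    -- The tilted vector `s • lincomb φ x + g` has scale `(s + 1) * ‖x‖ * σ`, so `hmax` would need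
    -- `(2 * s + 1) * ‖x‖ ^ 2 ≤ ‖g‖ ^ 2`. This choice makes the right side `s * ‖x‖ ^ 2`, which is
    -- too small.
    set s := ‖g‖ ^ 2 / ‖x‖ ^ 2
    have hs : s * ‖x‖ ^ 2 = ‖g‖ ^ 2 := by simp only [s]; field_simp
    have hs0 : 0 ≤ s := by positivity
    have hlaw : (fun f => ⟪s • lincomb φ x + g, f⟫) =ᵐ[P]
        fun f => ⟪(s + 1) • lincomb φ x, f⟫ := by
      filter_upwards [hgx] with f hf
      rw [inner_add_left, hf, real_inner_smul_left, real_inner_smul_left]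
      ring
    have h1 := hmax (s • lincomb φ x + g)
    rw [Measure.map_congr hlaw, scale_smul hsc hP2, scale_lincomb hsc hP2 hsph ⟨0, hn⟩,
      ← mul_assoc, abs_of_nonneg (by linarith)] at h1
    have h2 := le_of_mul_le_mul_right h1 hpos
    have h3 : ‖s • lincomb φ x + g‖ ^ 2 = s ^ 2 * ‖x‖ ^ 2 + ‖g‖ ^ 2 := by
      rw [norm_add_sq_real, real_inner_smul_left, inner_lincomb_left,
        show scores φ g = 0 from by ext k; exact hg k, norm_smul, hφ.orthonormal.norm_lincomb,
        mul_pow, Real.norm_eq_abs, sq_abs]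
      simp
    have h4 : ((s + 1) * ‖x‖) ^ 2 ≤ ‖s • lincomb φ x + g‖ ^ 2 :=
      pow_le_pow_left₀ (by positivity) h2 2
    rw [h3, ← hs] at h4
    have : 0 < ‖x‖ ^ 2 := by positivity
    nlinarith
  filter_upwards [hgx] with f hf
  rw [hf, inner_lincomb_left, hx0, inner_zero_left]

end PrincipalComponents

/-! ### Passing between orthonormal bases of the same span. -/

section ChangeOfSystem

variable {H : Type*} [NormedAddCommGroup H] [InnerProductSpace ℝ H] {n : ℕ} {φ ψ : Fin n → H}

lemma lincomb_add (φ : Fin n → H) (x y : EuclideanSpace ℝ (Fin n)) :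
    lincomb φ (x + y) = lincomb φ x + lincomb φ y := by
  simp [lincomb, add_smul, Finset.sum_add_distrib]

lemma lincomb_smul (φ : Fin n → H) (c : ℝ) (x : EuclideanSpace ℝ (Fin n)) :
    lincomb φ (c • x) = c • lincomb φ x := by
  simp [lincomb, Finset.smul_sum, smul_smul]

lemma scores_smul (φ : Fin n → H) (c : ℝ) (f : H) : scores φ (c • f) = c • scores φ f := by
  ext k; simp [scores_apply, inner_smul_right]

/-- Two orthonormal systems with the same span are related by an isometry of the scores. -/
lemma exists_isometry_scores_lincomb (hφ : Orthonormal ℝ φ) (hψ : Orthonormal ℝ ψ)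
    (h : ∀ m, φ m = lincomb ψ (scores ψ (φ m))) :
    ∃ U : EuclideanSpace ℝ (Fin n) ≃ₗᵢ[ℝ] EuclideanSpace ℝ (Fin n),
      ∀ x, scores ψ (lincomb φ x) = U x := by
  let F : EuclideanSpace ℝ (Fin n) →ₗ[ℝ] EuclideanSpace ℝ (Fin n) :=
    { toFun := fun x => scores ψ (lincomb φ x)
      map_add' := fun x y => by rw [lincomb_add, scores_add]
      map_smul' := fun c x => by rw [lincomb_smul, scores_smul, RingHom.id_apply] }
  have hmem : ∀ x, lincomb φ x = lincomb ψ (F x) := fun x => by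
    have h1 : ∀ k, x k • φ k = lincomb ψ (scores ψ (x k • φ k)) := fun k => by
      rw [scores_smul, lincomb_smul, ← h k]
    let G : H →ₗ[ℝ] H :=
      { toFun := fun f => lincomb ψ (scores ψ f)
        map_add' := fun f g => by rw [scores_add, lincomb_add]
        map_smul' := fun c f => by rw [scores_smul, lincomb_smul, RingHom.id_apply] }
    change lincomb φ x = G (lincomb φ x)
    rw [lincomb, map_sum]
    exact Finset.sum_congr rfl fun k _ => h1 k
  refine ⟨LinearIsometry.toLinearIsometryEquiv ⟨F, fun x => ?_⟩ rfl, fun x => rfl⟩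
  rw [← hψ.norm_lincomb, ← hmem, hφ.norm_lincomb]

variable [MeasurableSpace H] [BorelSpace H] {P : Measure H}

lemma map_scores_eq_map_map_scores (hspan : ∀ᵐ f ∂P, f = lincomb φ (scores φ f))
    {U : EuclideanSpace ℝ (Fin n) ≃ₗᵢ[ℝ] EuclideanSpace ℝ (Fin n)}
    (hU : ∀ x, scores ψ (lincomb φ x) = U x) :
    P.map (scores ψ) = (P.map (scores φ)).map U := by
  rw [Measure.map_map U.continuous.measurable (continuous_scores φ).measurable]
  refine Measure.map_congr ?_
  filter_upwards [hspan] with f hf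
  rw [Function.comp_apply, ← hU, ← hf]

end ChangeOfSystem

/-! ### Regression surfaces and the functional linear model in scores. -/

section Surfaces

variable {a b : ℝ} {M K : ℕ}

lemma coeFn_lincomb {n : ℕ} (φ : Fin n → L2I a b) (x : EuclideanSpace ℝ (Fin n)) :
    ∀ᵐ t ∂(volume.restrict (Icc a b)), lincomb φ x t = ∑ k, x k * φ k t := by
  have h : ∀ s : Finset (Fin n), ∀ᵐ t ∂(volume.restrict (Icc a b)),
      (∑ k ∈ s, x k • φ k : L2I a b) t = ∑ k ∈ s, x k * φ k t := by
    intro s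
    induction s using Finset.induction_on with
    | empty =>
      simp only [Finset.sum_empty]
      exact Lp.coeFn_zero _ _ _
    | insert k s hk ih =>
      rw [Finset.sum_insert hk]
      filter_upwards [ih, Lp.coeFn_add (x k • φ k) (∑ i ∈ s, x i • φ i),
        Lp.coeFn_smul (x k) (φ k)] with t h1 h2 h3
      rw [h2, Pi.add_apply, h1, h3, Finset.sum_insert hk]
      rfl
  exact h Finset.univ

lemma EqOnSquare.symm {β γ : ℝ → ℝ → ℝ} (h : EqOnSquare a b β γ) : EqOnSquare a b γ β :=
  Filter.Eventually.mono h fun _ hp => Eq.symm hp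

lemma EqOnSquare.trans {β γ δ : ℝ → ℝ → ℝ} (h : EqOnSquare a b β γ) (h' : EqOnSquare a b γ δ) :
    EqOnSquare a b β δ := by
  filter_upwards [h, h'] with p hp hp'
  rw [hp, hp']

/-- The coefficients of a surface after a change of orthonormal systems. -/
noncomputable def changeCoeff (φ φ' : Fin M → L2I a b) (ψ ψ' : Fin K → L2I a b)
    (B : Matrix (Fin M) (Fin K) ℝ) : Matrix (Fin M) (Fin K) ℝ :=
  Matrix.of fun i j => ∑ m, ∑ k, B m k * scores φ' (φ m) i * scores ψ' (ψ k) j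

lemma eqOnSquare_surface_changeCoeff {φ φ' : Fin M → L2I a b} {ψ ψ' : Fin K → L2I a b}
    (hφ : ∀ m, φ m = lincomb φ' (scores φ' (φ m))) (hψ : ∀ k, ψ k = lincomb ψ' (scores ψ' (ψ k)))
    (B : Matrix (Fin M) (Fin K) ℝ) :
    EqOnSquare a b (surface φ ψ B) (surface φ' ψ' (changeCoeff φ φ' ψ ψ' B)) := by
  have h1 : ∀ᵐ s ∂(volume.restrict (Icc a b)), ∀ m,
      φ m s = ∑ i, scores φ' (φ m) i * φ' i s := ae_all_iff.2 fun m => by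
    filter_upwards [coeFn_lincomb φ' (scores φ' (φ m))] with s hs
    rw [← hs, ← hφ m]
  have h2 : ∀ᵐ t ∂(volume.restrict (Icc a b)), ∀ k,
      ψ k t = ∑ j, scores ψ' (ψ k) j * ψ' j t := ae_all_iff.2 fun k => by
    filter_upwards [coeFn_lincomb ψ' (scores ψ' (ψ k))] with s hs
    rw [← hs, ← hψ k]
  unfold EqOnSquare
  filter_upwards [Measure.quasiMeasurePreserving_fst.ae h1,
    Measure.quasiMeasurePreserving_snd.ae h2] with p hp1 hp2
  simp only [surface, changeCoeff, Matrix.of_apply, Finset.sum_mul]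
  calc ∑ m, ∑ k, B m k * φ m p.1 * ψ k p.2
      = ∑ m, ∑ k, ∑ i, ∑ j, B m k * scores φ' (φ m) i * scores ψ' (ψ k) j * φ' i p.1 * ψ' j p.2 := by
        refine Finset.sum_congr rfl fun m _ => Finset.sum_congr rfl fun k _ => ?_
        rw [hp1 m, hp2 k, mul_assoc, Finset.sum_mul_sum, Finset.mul_sum]
        refine Finset.sum_congr rfl fun i _ => ?_
        rw [Finset.mul_sum]
        exact Finset.sum_congr rfl fun j _ => by ring
    _ = ∑ m, ∑ i, ∑ k, ∑ j, B m k * scores φ' (φ m) i * scores ψ' (ψ k) j * φ' i p.1 * ψ' j p.2 :=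
        Finset.sum_congr rfl fun m _ => Finset.sum_comm
    _ = ∑ i, ∑ m, ∑ k, ∑ j, B m k * scores φ' (φ m) i * scores ψ' (ψ k) j * φ' i p.1 * ψ' j p.2 :=
        Finset.sum_comm
    _ = ∑ i, ∑ m, ∑ j, ∑ k, B m k * scores φ' (φ m) i * scores ψ' (ψ k) j * φ' i p.1 * ψ' j p.2 :=
        Finset.sum_congr rfl fun i _ => Finset.sum_congr rfl fun m _ => Finset.sum_comm
    _ = _ := Finset.sum_congr rfl fun i _ => Finset.sum_comm

lemma integral_mul_surface {φ : Fin M → L2I a b} {ψ : Fin K → L2I a b}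
    (B : Matrix (Fin M) (Fin K) ℝ) (f : L2I a b) (t : ℝ) :
    ∫ s in Icc a b, f s * surface φ ψ B s t = ∑ k, rowMul B (scores φ f) k * ψ k t := by
  have hi : ∀ m, Integrable (fun s => φ m s * f s) (volume.restrict (Icc a b)) := fun m => by
    have := L2.integrable_inner (𝕜 := ℝ) (φ m) f
    simpa [mul_comm] using this
  have hin : ∀ m, scores φ f m = ∫ s in Icc a b, φ m s * f s := fun m => by
    rw [scores_apply, L2.inner_def]
    simp [mul_comm]
  have h1 : ∀ s, f s * surface φ ψ B s t = ∑ m, ∑ k, B m k * ψ k t * (φ m s * f s) := fun s => by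
    rw [surface, Finset.mul_sum]
    refine Finset.sum_congr rfl fun m _ => ?_
    rw [Finset.mul_sum]
    exact Finset.sum_congr rfl fun k _ => by ring
  simp_rw [h1]
  rw [integral_finsetSum _ fun m _ => integrable_finsetSum _ fun k _ => (hi m).const_mul _,
    Finset.sum_congr rfl fun m _ => integral_finsetSum _ fun k _ => (hi m).const_mul _]
  simp_rw [integral_const_mul, ← hin, rowMul_apply, Finset.sum_mul]
  rw [Finset.sum_comm]
  exact Finset.sum_congr rfl fun k _ => Finset.sum_congr rfl fun m _ => by ring

/-- The functional linear model written in terms of scores. -/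
lemma ae_eq_lincomb_add {Ω : Type*} [MeasurableSpace Ω] {μ : Measure Ω} {X Y ε : Ω → L2I a b}
    {β : ℝ → ℝ → ℝ}
    (hmodel : ∀ᵐ ω ∂μ, ∀ᵐ t ∂(volume.restrict (Icc a b)),
      Y ω t = (∫ s in Icc a b, X ω s * β s t) + ε ω t)
    {φ : Fin M → L2I a b} {ψ : Fin K → L2I a b} {B : Matrix (Fin M) (Fin K) ℝ}
    (hβ : EqOnSquare a b β (surface φ ψ B)) :
    ∀ᵐ ω ∂μ, Y ω = lincomb ψ (rowMul B (scores φ (X ω))) + ε ω := by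
  -- The model integrates over `s` for fixed `t`, so the null set is sliced along the second
  -- variable, which requires a swap.
  have hβ' : ∀ᵐ t ∂(volume.restrict (Icc a b)), ∀ᵐ s ∂(volume.restrict (Icc a b)),
      β s t = surface φ ψ B s t := by
    have h1 : ∀ᵐ p ∂((volume.restrict (Icc a b)).prod (volume.restrict (Icc a b))),
        β (Prod.swap p).1 (Prod.swap p).2 = surface φ ψ B (Prod.swap p).1 (Prod.swap p).2 :=
      (Measure.measurePreserving_swap (μ := volume.restrict (Icc a b))
        (ν := volume.restrict (Icc a b))).quasiMeasurePreserving.ae hβ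
    exact Measure.ae_ae_of_ae_prod h1
  filter_upwards [hmodel] with ω hω
  refine Lp.ext ?_
  filter_upwards [hω, hβ', Lp.coeFn_add (lincomb ψ (rowMul B (scores φ (X ω)))) (ε ω),
    coeFn_lincomb ψ (rowMul B (scores φ (X ω)))] with t h1 h2 h3 h4
  rw [h1, h3, Pi.add_apply, h4, ← integral_mul_surface]
  congr 1
  refine integral_congr_ae ?_
  filter_upwards [h2] with s hs
  rw [hs]

end Surfaces

/-! ### The Gaussian error: square root of the covariance and rotations. -/

section ErrorLaw

variable {K : ℕ}

open scoped MatrixOrder in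
lemma exists_continuousLinearEquiv_sqrt {S : Matrix (Fin K) (Fin K) ℝ} (hS : S.PosDef) :
    ∃ T : EuclideanSpace ℝ (Fin K) ≃L[ℝ] EuclideanSpace ℝ (Fin K),
      multivariateGaussian 0 S = (stdGaussian (EuclideanSpace ℝ (Fin K))).map T := by
  have hu : IsUnit (CFC.sqrt S) := by
    rw [Matrix.isUnit_iff_isUnit_det, isUnit_iff_ne_zero]
    intro h
    have h1 := congrArg Matrix.det (CFC.sqrt_mul_sqrt_self S hS.posSemidef.nonneg)
    rw [Matrix.det_mul, h, zero_mul] at h1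
    exact hS.det_pos.ne h1
  have hT := hu.map (Matrix.toEuclideanCLM (𝕜 := ℝ) (n := Fin K))
  refine ⟨ContinuousLinearEquiv.unitsEquiv ℝ _ hT.unit, ?_⟩
  rw [multivariateGaussian]
  congr 1
  ext1 x
  rw [zero_add]
  rfl

lemma integral_max_sub_sq_lt_map_isometry {κ : Measure (EuclideanSpace ℝ (Fin K))}
    (hκA : ∀ c : EuclideanSpace ℝ (Fin K), c ≠ 0 → ∀ r : ℝ, 0 < r →
      ∫ q, max (r - ‖q + c‖ ^ 2) 0 ∂κ < ∫ q, max (r - ‖q‖ ^ 2) 0 ∂κ)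
    (U : EuclideanSpace ℝ (Fin K) ≃ₗᵢ[ℝ] EuclideanSpace ℝ (Fin K))
    (c : EuclideanSpace ℝ (Fin K)) (hc : c ≠ 0) (r : ℝ) (hr : 0 < r) :
    ∫ q, max (r - ‖q + c‖ ^ 2) 0 ∂(κ.map U) < ∫ q, max (r - ‖q‖ ^ 2) 0 ∂(κ.map U) := by
  have hU : AEMeasurable U κ := U.continuous.measurable.aemeasurable
  rw [integral_map hU (by fun_prop), integral_map hU (by fun_prop)]
  have h1 : ∀ q, ‖U q + c‖ = ‖q + U.symm c‖ := fun q => by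
    rw [← U.norm_map (q + U.symm c), map_add, U.apply_symm_apply]
  simp_rw [h1, U.norm_map]
  exact hκA _ (by simpa using hc) r hr

end ErrorLaw

/-! ### Joint law of the scores, and the theorem. -/

section Consistency

variable {Ω : Type*} [MeasurableSpace Ω] {μ : Measure Ω} [IsProbabilityMeasure μ]
  {a b : ℝ} {M K : ℕ} {X Y ε : Ω → L2I a b}

lemma map_scores_pair (hX : Measurable X) (hY : Measurable Y) (hε : Measurable ε)
    (hindep : IndepFun X ε μ)
    {φ : Fin M → L2I a b} {ψ : Fin K → L2I a b} (hψ : Orthonormal ℝ ψ)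
    {B : Matrix (Fin M) (Fin K) ℝ}
    (hmodel : ∀ᵐ ω ∂μ, Y ω = lincomb ψ (rowMul B (scores φ (X ω))) + ε ω) :
    (μ.map fun ω => (X ω, Y ω)).map (fun p => (scores φ p.1, scores ψ p.2)) =
      (((μ.map X).map (scores φ)).prod ((μ.map ε).map (scores ψ))).map
        fun p => (p.1, rowMul B p.1 + p.2) := by
  have hsφ := (continuous_scores φ).measurable
  have hsψ := (continuous_scores ψ).measurable
  have hprod := (indepFun_iff_map_prod_eq_prod_map_map hX.aemeasurable hε.aemeasurable).1 hindep
  have hm1 : Measurable fun p : L2I a b × L2I a b => (scores φ p.1, scores ψ p.2) :=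
    (hsφ.comp measurable_fst).prodMk (hsψ.comp measurable_snd)
  have : IsProbabilityMeasure (μ.map X) := Measure.isProbabilityMeasure_map hX.aemeasurable
  have : IsProbabilityMeasure (μ.map ε) := Measure.isProbabilityMeasure_map hε.aemeasurable
  rw [Measure.map_prod_map _ _ hsφ hsψ, ← hprod,
    Measure.map_map hm1 (hX.prodMk hY),
    Measure.map_map (hsφ.prodMap hsψ) (hX.prodMk hε),
    Measure.map_map (by fun_prop) ((hsφ.prodMap hsψ).comp (hX.prodMk hε))]
  refine Measure.map_congr ?_
  filter_upwards [hmodel] with ω hω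
  simp only [Function.comp_apply, Prod.map_apply]
  rw [hω, scores_add, hψ.scores_lincomb]

omit [IsProbabilityMeasure μ] in
lemma memLp_of_ae_eq_lincomb {ψ : Fin K → L2I a b} (hY : Measurable Y)
    [SecondCountableTopology (L2I a b)]
    (hψ : Orthonormal ℝ ψ) {v : Ω → EuclideanSpace ℝ (Fin K)} (hv : MemLp v 2 μ)
    (h : ∀ᵐ ω ∂μ, Y ω = lincomb ψ (v ω)) : MemLp Y 2 μ :=
  hv.congr_norm hY.aestronglyMeasurable (h.mono fun ω hω => by rw [hω, hψ.norm_lincomb])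

end Consistency

theorem lemma1 {Ω : Type*} [MeasurableSpace Ω] (μ : Measure Ω) [IsProbabilityMeasure μ]
    (a b : ℝ) (hab : a < b)
    -- the predictor, response and residual processes and the regression function
    (X Y ε : Ω → L2I a b) (hX : Measurable X) (hY : Measurable Y) (hε : Measurable ε)
    (hX2 : MemLp X 2 μ) (hX0 : ∫ ω, X ω ∂μ = 0)
    (β : ℝ → ℝ → ℝ)
    (hmodel : ∀ᵐ ω ∂μ, ∀ᵐ t ∂(volume.restrict (Icc a b)),
      Y ω t = (∫ s in Icc a b, X ω s * β s t) + ε ω t)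
    (hindep : IndepFun X ε μ)
    -- the scale functional, the trimming proportion, the robust principal components
    (sc : Measure ℝ → ℝ) (hsc : IsScaleFunctional sc)
    (α : ℝ) (hα0 : 0 < α) (hα1 : α ≤ 1)
    (M₀ K₀ : ℕ) (hM₀ : 0 < M₀) (hK₀ : 0 < K₀)
    (φX : Fin M₀ → L2I a b) (φY : Fin K₀ → L2I a b)
    (hφX : IsRobustFPC sc (μ.map X) φX) (hφY : IsRobustFPC sc (μ.map Y) φY)
    (S : Matrix (Fin K₀) (Fin K₀) ℝ) (hS : S.PosSemidef)
    -- the six conditions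
    (hC1 : HasFiniteKL (μ.map X) M₀)
    (hC2 : HasFiniteKL (μ.map Y) K₀)
    (hC3 : IsGaussianInSpan (μ.map ε) φY S)
    (hC4 : ∃ B : Matrix (Fin M₀) (Fin K₀) ℝ, EqOnSquare a b β (surface φX φY B))
    (hC5 : HasSphericalScores (μ.map X) φX)
    (hC6 : HasSphericalScores (μ.map Y) φY) :
    -- Fisher consistency of the robust principal components
    (∀ φ : Fin M₀ → L2I a b, IsRobustFPC sc (μ.map X) φ → ∃ ev, IsFPC (μ.map X) φ ev) ∧
    (∀ ψ : Fin K₀ → L2I a b, IsRobustFPC sc (μ.map Y) ψ → ∃ ev, IsFPC (μ.map Y) ψ ev) ∧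
    -- Fisher consistency of the regression functional
    FisherConsistent a b
      (robustFLR sc α M₀ K₀ Matrix.trace (μ.map fun ω => (X ω, Y ω))) β ∧
    (S.PosDef → FisherConsistent a b
      (robustFLR sc α M₀ K₀ Matrix.det (μ.map fun ω => (X ω, Y ω))) β) := by
  have hfact : Fact ((2 : ℝ≥0∞) ≠ ⊤) := ⟨by norm_num⟩
  have hsecond : SecondCountableTopology (L2I a b) := Lp.SecondCountableTopology
  have hprX : IsProbabilityMeasure (μ.map X) := Measure.isProbabilityMeasure_map hX.aemeasurable
  have hprY : IsProbabilityMeasure (μ.map Y) := Measure.isProbabilityMeasure_map hY.aemeasurable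
  have hprε : IsProbabilityMeasure (μ.map ε) := Measure.isProbabilityMeasure_map hε.aemeasurable
  obtain ⟨B, hB⟩ := hC4
  -- the predictor
  have hPX2 : MemLp id 2 (μ.map X) :=
    (memLp_map_measure_iff aestronglyMeasurable_id hX.aemeasurable).2 hX2
  have hPX0 : ∫ f, f ∂(μ.map X) = 0 := by
    exact (integral_map hX.aemeasurable (f := fun f => f) aestronglyMeasurable_id).trans hX0
  have hspanX := hφX.ae_eq_lincomb hsc hPX2 hPX0 hM₀ hC1 hC5
  -- the error
  have hspanε : ∀ᵐ f ∂(μ.map ε), f = lincomb φY (scores φY f) := hC3.1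
  have hq2 : MemLp (fun ω => scores φY (ε ω)) 2 μ := by
    have h1 : MemLp id 2 ((μ.map ε).map (scores φY)) := by
      rw [hC3.2]; exact IsGaussian.memLp_two_id
    have h2 := (memLp_map_measure_iff aestronglyMeasurable_id
      (continuous_scores φY).measurable.aemeasurable).1 h1
    exact (memLp_map_measure_iff (continuous_scores φY).aestronglyMeasurable
      hε.aemeasurable).1 h2
  -- the response
  have hYlin : ∀ᵐ ω ∂μ, Y ω =
      lincomb φY (rowMul B (scores φX (X ω)) + scores φY (ε ω)) := by
    filter_upwards [ae_eq_lincomb_add hmodel hB, ae_of_ae_map hε.aemeasurable hspanε]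
      with ω h1 h2
    rw [h1, lincomb_add, ← h2]
  have hz2 : MemLp (fun ω => rowMul B (scores φX (X ω)) + scores φY (ε ω)) 2 μ := by
    refine MemLp.add ?_ hq2
    have h1 := (memLp_map_measure_iff (continuous_scores φX).aestronglyMeasurable
      hX.aemeasurable).1 (memLp_scores hPX2 φX)
    exact (rowMul B).comp_memLp' h1
  have hPY2 : MemLp id 2 (μ.map Y) :=
    (memLp_map_measure_iff aestronglyMeasurable_id hY.aemeasurable).2
      (memLp_of_ae_eq_lincomb hY hφY.orthonormal hz2 hYlin)
  have hspanY : ∀ᵐ f ∂(μ.map Y), f = lincomb φY (scores φY f) := by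
    have hm : MeasurableSet {f : L2I a b | f = lincomb φY (scores φY f)} := by
      refine measurableSet_eq_fun measurable_id (Continuous.measurable ?_)
      unfold lincomb
      simp only [scores_apply]
      fun_prop
    rw [ae_map_iff hY.aemeasurable hm]
    filter_upwards [hYlin] with ω hω
    rw [hω, hφY.orthonormal.scores_lincomb]
  -- the regression coefficients with respect to any robust systems
  have hreg : ∀ (φ : Fin M₀ → L2I a b) (ψ : Fin K₀ → L2I a b), IsRobustFPC sc (μ.map X) φ →
      IsRobustFPC sc (μ.map Y) ψ → ∃ B' : Matrix (Fin M₀) (Fin K₀) ℝ,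
      EqOnSquare a b (surface φ ψ B') β ∧
      (∀ B₁, IsMLTS Matrix.trace α ((μ.map fun ω => (X ω, Y ω)).map
        fun p => (scores φ p.1, scores ψ p.2)) B₁ ↔ B₁ = B') ∧
      (S.PosDef → ∀ B₁, IsMLTS Matrix.det α ((μ.map fun ω => (X ω, Y ω)).map
        fun p => (scores φ p.1, scores ψ p.2)) B₁ ↔ B₁ = B') := by
    intro φ ψ hφ hψ
    have hbX := hφX.orthonormal.lincomb_eq_of_forall_eq_lincomb hφ.orthonormal
      (hφ.eq_lincomb hsc hPX2 hφX.orthonormal hC5 hspanX)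
    have hbY := hφY.orthonormal.lincomb_eq_of_forall_eq_lincomb hψ.orthonormal
      (hψ.eq_lincomb hsc hPY2 hφY.orthonormal hC6 hspanY)
    obtain ⟨UX, hUX⟩ := exists_isometry_scores_lincomb hφX.orthonormal hφ.orthonormal hbX
    obtain ⟨UY, hUY⟩ := exists_isometry_scores_lincomb hφY.orthonormal hψ.orthonormal hbY
    have hsurf := hB.trans (eqOnSquare_surface_changeCoeff hbX hbY B)
    set B' := changeCoeff φX φ φY ψ B
    have hJ := map_scores_pair hX hY hε hindep hψ.orthonormal (ae_eq_lincomb_add hmodel hsurf)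
    -- Sphericity absorbs the rotation of the predictor scores; the error scores are genuinely
    -- rotated by `UY`.
    have hν : (μ.map X).map (scores φ) = (μ.map X).map (scores φX) := by
      rw [map_scores_eq_map_map_scores hspanX hUX, hC5.map_eq]
    have hκ : (μ.map ε).map (scores ψ) = (multivariateGaussian 0 S).map UY := by
      rw [map_scores_eq_map_map_scores hspanε hUY, hC3.2]
    rw [hν, hκ] at hJ
    have hprν := isProbabilityMeasure_map_scores (P := μ.map X) φX
    have hνac := hC5.absolutelyContinuous
    have hνsym : ((μ.map X).map (scores φX)).map (fun z => -z) = (μ.map X).map (scores φX) :=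
      hC5.map_eq (LinearIsometryEquiv.neg ℝ)
    have hν2 := memLp_id_map_scores hPX2 φX
    have hUYm : AEMeasurable UY (multivariateGaussian 0 S) :=
      UY.continuous.measurable.aemeasurable
    refine ⟨B', hsurf.symm, fun B₁ => ?_, fun hSpd B₁ => ?_⟩
    · have hprκ : IsProbabilityMeasure ((multivariateGaussian 0 S).map UY) :=
        Measure.isProbabilityMeasure_map hUYm
      refine isMLTS_trace_iff hM₀ hνac hνsym hν2 ?_ ?_
        (integral_max_sub_sq_lt_map_isometry
          (fun c hc r hr => integral_max_sub_sq_lt_multivariateGaussian S hc hr) UY) hα0 hα1 hJ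
      · refine (memLp_map_measure_iff aestronglyMeasurable_id hUYm).2 ?_
        exact UY.toContinuousLinearEquiv.toContinuousLinearMap.comp_memLp'
          IsGaussian.memLp_two_id
      · refine (integral_map hUYm (f := fun q => q) aestronglyMeasurable_id).trans ?_
        have h1 := UY.toContinuousLinearEquiv.toContinuousLinearMap.integral_comp_comm
          (IsGaussian.integrable_id (μ := multivariateGaussian 0 S))
        rw [integral_id_multivariateGaussian'] at h1
        exact h1.trans (map_zero _)
    · obtain ⟨T, hT⟩ := exists_continuousLinearEquiv_sqrt hSpd
      -- The rotation of the error scores is absorbed into the map applied to a standard Gaussian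
      -- vector.
      refine isMLTS_det_iff hM₀ hK₀ hνac hνsym hν2 hα0 hα1
        (T.trans UY.toContinuousLinearEquiv) (hJ.trans ?_)
      rw [hT, Measure.map_map UY.continuous.measurable T.continuous.measurable]
      conv_lhs => rw [← Measure.map_id (μ := (μ.map X).map (scores φX))]
      rw [Measure.map_prod_map _ _ measurable_id
        (UY.continuous.measurable.comp T.continuous.measurable),
        Measure.map_map (by fun_prop) (by fun_prop)]
      rfl
  have hfst : (μ.map fun ω => (X ω, Y ω)).fst = μ.map X := Measure.fst_map_prodMk hY
  have hsnd : (μ.map fun ω => (X ω, Y ω)).snd = μ.map Y := Measure.snd_map_prodMk hX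
  obtain ⟨B₀, hB₀, htr₀, hdet₀⟩ := hreg φX φY hφX hφY
  refine ⟨fun φ hφ => hφ.exists_isFPC hsc hPX2 hφX.orthonormal hC5 hspanX,
    fun ψ hψ => hψ.exists_isFPC hsc hPY2 hφY.orthonormal hC6 hspanY, ⟨⟨_, φX, φY, B₀, ?_, ?_,
      (htr₀ B₀).2 rfl, rfl⟩, ?_⟩, fun hSpd => ⟨⟨_, φX, φY, B₀, ?_, ?_,
      (hdet₀ hSpd B₀).2 rfl, rfl⟩, ?_⟩⟩
  · rwa [hfst]
  · rwa [hsnd]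
  · rintro γ ⟨φ, ψ, B₁, hφ, hψ, hB₁, rfl⟩
    rw [hfst] at hφ
    rw [hsnd] at hψ
    obtain ⟨B', hB', htr, -⟩ := hreg φ ψ hφ hψ
    rw [(htr B₁).1 hB₁]
    exact hB'
  · rwa [hfst]
  · rwa [hsnd]
  · rintro γ ⟨φ, ψ, B₁, hφ, hψ, hB₁, rfl⟩
    rw [hfst] at hφ
    rw [hsnd] at hψ
    obtain ⟨B', hB', -, hdet⟩ := hreg φ ψ hφ hψ
    rw [(hdet hSpd B₁).1 hB₁]
    exact hB'
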